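/- **Conventions.** A $(\vee,0)$-semilattice is a join-semilattice with least element $0$. For a lattice $L$ and $x,y\in L$, let $\Theta_L(x,y)$ be the least congruence of $L$ identifying $x$ and $y$ (a *principal congruence*), and let $\mathrm{Con}_c L$ be the $(\vee,0)$-semilattice, under inclusion, of all finite joins of principal congruences of $L$. For a positive integer $m$, $L$ has *$(m+1)$-permutable congruences* if $a\vee b=c_0\circ c_1\circ\cdots\circ c_m$ for all congruences $a,b$ of $L$, where $c_i=a$ for $i$ even, $c_i=b$ for $i$ odd, and $\circ$ is the relational product. Put $\varepsilon(k)=0$ if $k$ is even and $\varepsilon(k)=1$ if $k$ is odd. **The semilattices $\mathcal G(\Omega)$.** For a set $\Omega$, let $\mathcal L(\Omega)$ be the $(\vee,0)$-semilattice defined by generators $1$ and $a_0^\xi,a_1^\xi$ ($\xi\in\Omega$) and relations $a_0^\xi\vee a_1^\xi=1$ ($\xi\in\Omega$). For a $(\vee,0)$-semilattice $S$, let $\mathcal R(S)$ be the $(\vee,0)$-semilattice obtained by freely adjoining to $S$ elements $\bowtie(a,b,c)$, for all $a,b,c\in S$ with $c\le a\vee b$, subject only to the relations $c=\bowtie(a,b,c)\vee\bowtie(b,a,c)$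 and $\bowtie(a,b,c)\le a$; it contains $S$ as a $(\vee,0)$-subsemilattice. Put $\mathcal R^0(S)=S$, $\mathcal R^{n+1}(S)=\mathcal R(\mathcal R^n(S))$, $\mathcal D(S)=\bigcup_{n<\omega}\mathcal R^n(S)$, and $\mathcal G(\Omega)=\mathcal D(\mathcal L(\Omega))$. For a cardinal $\kappa$, $\mathcal G(\kappa)$ stands for $\mathcal G(\Omega)$ with $\Omega$ any set of cardinality $\kappa$. **The properties $\mathrm{CLR}$ and $\mathrm{CLR}_m$.** For a positive integer $m$ and a nonempty set $\Omega$, let $\mathrm{Sem}(m,\Omega)$ be the join-semilattice defined by generators $\bar 0$, $\bar 1$ and $k\cdot\dot\xi$ ($0\le k\le m+1$, $\xi\in\Omega$) and relations $\bar 0=0\cdot\dot\xi\le 1\cdot\dot\xi\le\cdots\le m\cdot\dot\xi\le(m+1)\cdot\dot\xi=\bar 1$ ($\xi\in\Omega$); let $\mathrm{Sem}(m,\varnothing)$ be the chain $\bar 0<\bar 1$. Let $S$ be a $(\vee,0)$-semilattice and $e\in S$. Then $S$ satisfies $\mathrm{CLR}(e)$ if for every nonempty set $\Omega$ and all families $(a_i^\xi)_{\xi\in\Omega,\,i\in\{0,1\}}$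 in $S$ with $e\le a_0^\xi\vee a_1^\xi$ for all $\xi\in\Omega$, there are a decomposition $\Omega=\bigcup_{m\ge 1}\Omega_m$ into pairwise disjoint, possibly empty sets and maps $c_m\colon\mathrm{Sem}(m,\Omega_m)\times\mathrm{Sem}(m,\Omega_m)\to S$, for $m\geq 1$, such that for every positive integer $m$ and all $p,q,r\in\mathrm{Sem}(m,\Omega_m)$: 1. $p\le q$ implies $c_m(p,q)=0$; 2. $c_m(p,r)\le c_m(p,q)\vee c_m(q,r)$; 3. $c_m(p\vee q,r)=c_m(p,r)\vee c_m(q,r)$; 4. $c_m(\bar 1,\bar 0)=e$; 5. $c_m((k+1)\cdot\dot\xi,\,k\cdot\dot\xi)\le a_{\varepsilon(k)}^\xi$ for all $\xi\in\Omega_m$ and all integers $k$ with $0\le k\le m$. For a fixed positive integer $m$, $S$ satisfies $\mathrm{CLR}_m(e)$ if, for all such $\Omega$ and $(a_i^\xi)$, there is a map $c_m\colon\mathrm{Sem}(m,\Omega)\times\mathrm{Sem}(m,\Omega)\to S$ satisfying (1)–(5) with $\Omega_m=\Omega$. **Theorem 8.2.** Let $L$ be a lattice and let $e$ be a principal congruence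 of $L$. Then $\mathrm{Con}_c L$ satisfies $\mathrm{CLR}(e)$. Furthermore, if $m$ is a positive integer and $L$ has $(m+1)$-permutable congruences, then $\mathrm{Con}_c L$ satisfies $\mathrm{CLR}_m(e)$. On the other hand, $\mathcal G(\aleph_{\omega+1})$ does not satisfy $\mathrm{CLR}(1)$, and for every positive integer $m$, $\mathcal G(\aleph_{2^m})$ does not satisfy $\mathrm{CLR}_m(1)$. -/

import Mathlib

open Cardinal Ordinal

universe u v

namespace CLP

/-! ### Semilattices with zero given by generators and relations

A relation of the form `x ≤ ⋁ P`, with `x` a generator and `P` a finite set of generators, is recorded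
as a rule `r P x`. Then `x ≤ ⋁ A` holds in the presented `(∨,0)`-semilattice iff `x` can be derived
from `A` by means of the rules, so that the presented semilattice is the semilattice of all
finitely generated deductively closed sets of generators, ordered by inclusion. -/

/-- `Derives r A x`: the inequality `x ≤ ⋁ A` follows from the relations `x' ≤ ⋁ P`, for `r P x'`. -/
inductive Derives {X : Type u} (r : Set X → X → Prop) (A : Set X) : X → Prop
  | mem {x : X} : x ∈ A → Derives r A x
  | rule {P : Set X} {x : X} : r P x → (∀ p ∈ P, Derives r A p) → Derives r A x

/-- The deductive closure of a set of generators. -/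
def cl {X : Type u} (r : Set X → X → Prop) (A : Set X) : Set X := {x | Derives r A x}

theorem subset_cl {X : Type u} (r : Set X → X → Prop) (A : Set X) : A ⊆ cl r A :=
  fun _ h => Derives.mem h

theorem cl_subset {X : Type u} {r : Set X → X → Prop} {A B : Set X} (h : A ⊆ cl r B) :
    cl r A ⊆ cl r B := by
  intro x hx
  induction hx with
  | mem hx => exact h hx
  | rule hr _ ih => exact Derives.rule hr ih

theorem cl_mono {X : Type u} {r : Set X → X → Prop} {A B : Set X} (h : A ⊆ B) :
    cl r A ⊆ cl r B := cl_subset (h.trans (subset_cl r B))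

/-- The `(∨,0)`-semilattice with generators the elements of `X`
and relations `x ≤ ⋁ P`, for `r P x`. -/
def Presented {X : Type u} (r : Set X → X → Prop) : Type u :=
  {I : Set X // ∃ A : Set X, A.Finite ∧ I = cl r A}

namespace Presented

variable {X : Type u} {r : Set X → X → Prop}

instance : PartialOrder (Presented r) :=
  inferInstanceAs (PartialOrder {I : Set X // ∃ A : Set X, A.Finite ∧ I = cl r A})

/-- The canonical image of a generator. -/
def gen (r : Set X → X → Prop) (x : X) : Presented r := ⟨cl r {x}, {x}, Set.finite_singleton x, rfl⟩

instance : SemilatticeSup (Presented r) where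
  sup I J := ⟨cl r (I.1 ∪ J.1), by
    obtain ⟨A, hA, hI⟩ := I.2
    obtain ⟨B, hB, hJ⟩ := J.2
    refine ⟨A ∪ B, hA.union hB, Set.Subset.antisymm (cl_subset ?_) (cl_mono ?_)⟩
    · rw [hI, hJ]
      exact Set.union_subset (cl_mono Set.subset_union_left) (cl_mono Set.subset_union_right)
    · rw [hI, hJ]
      exact Set.union_subset_union (subset_cl r A) (subset_cl r B)⟩
  le_sup_left I J := Set.subset_union_left.trans (subset_cl r (I.1 ∪ J.1))
  le_sup_right I J := Set.subset_union_right.trans (subset_cl r (I.1 ∪ J.1))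
  sup_le I J K hI hJ := by
    obtain ⟨C, hC, hK⟩ := K.2
    change cl r (I.1 ∪ J.1) ⊆ K.1
    have h : I.1 ∪ J.1 ⊆ K.1 := Set.union_subset hI hJ
    rw [hK] at h ⊢
    exact cl_subset h

instance : OrderBot (Presented r) where
  bot := ⟨cl r ∅, ∅, Set.finite_empty, rfl⟩
  bot_le I := by
    obtain ⟨A, hA, hI⟩ := I.2
    change cl r ∅ ⊆ I.1
    rw [hI]
    exact cl_mono (Set.empty_subset A)

theorem mem_of_derives (I : Presented r) {x : X} (h : Derives r I.1 x) : x ∈ I.1 := by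
  obtain ⟨A, hA, hI⟩ := I.2
  have h2 : cl r I.1 ⊆ cl r A := cl_subset hI.subset
  rw [hI]
  exact h2 h

theorem gen_le_iff {x : X} {I : Presented r} : gen r x ≤ I ↔ x ∈ I.1 := by
  constructor
  · intro h
    exact h (subset_cl r {x} rfl)
  · rintro h y hy
    refine I.mem_of_derives ?_
    exact cl_mono (Set.singleton_subset_iff.2 h) hy

end Presented

/-! ### The free distributive extension and its iterates -/

/-- The generators of `R S`: the elements of `S`, and a new element `⋈(a, b, c)` for all
`a b c : S` with `c ≤ a ∨ b`. -/
inductive RGen (S : Type u) [SemilatticeSup S] : Type u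
  | of (s : S) : RGen S
  | bow (a b c : S) (h : c ≤ a ⊔ b) : RGen S

/-- The relations of `R S`: those of `S` as a `(∨,0)`-semilattice, `⋈(a, b, c) ≤ a`, and
`c = ⋈(a, b, c) ∨ ⋈(b, a, c)`. -/
inductive RRel (S : Type u) [SemilatticeSup S] [OrderBot S] : Set (RGen S) → RGen S → Prop
  | zero : RRel S ∅ (RGen.of ⊥)
  | join (a b c : S) (h : c ≤ a ⊔ b) : RRel S {RGen.of a, RGen.of b} (RGen.of c)
  | bow_le_left (a b c : S) (h : c ≤ a ⊔ b) : RRel S {RGen.of a} (RGen.bow a b c h)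
  | bow_le (a b c : S) (h : c ≤ a ⊔ b) : RRel S {RGen.of c} (RGen.bow a b c h)
  | le_bow (a b c : S) (h : c ≤ a ⊔ b) (h' : c ≤ b ⊔ a) :
      RRel S {RGen.bow a b c h, RGen.bow b a c h'} (RGen.of c)

/-- The free distributive extension of `S`. -/
abbrev R (S : Type u) [SemilatticeSup S] [OrderBot S] : Type u := Presented (RRel S)

/-- The canonical embedding of `S` into `R S`. -/
def R.ofHom (S : Type u) [SemilatticeSup S] [OrderBot S] : SupBotHom S (R S) where
  toFun s := Presented.gen (RRel S) (RGen.of s)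
  map_sup' a b := by
    apply le_antisymm
    · rw [Presented.gen_le_iff]
      refine Derives.rule (RRel.join a b (a ⊔ b) le_rfl) ?_
      rintro p (rfl | rfl)
      · exact Derives.mem (Or.inl (subset_cl _ _ rfl))
      · exact Derives.mem (Or.inr (subset_cl _ _ rfl))
    · apply sup_le <;> rw [Presented.gen_le_iff]
      · refine Derives.rule (RRel.join (a ⊔ b) (a ⊔ b) a (by simp)) ?_
        rintro p (rfl | rfl) <;> exact Derives.mem rfl
      · refine Derives.rule (RRel.join (a ⊔ b) (a ⊔ b) b (by simp)) ?_
        rintro p (rfl | rfl) <;> exact Derives.mem rfl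
  map_bot' := by
    apply le_antisymm
    · rw [Presented.gen_le_iff]
      exact Derives.rule RRel.zero (fun p hp => hp.elim)
    · exact bot_le

/-- The iterates `S, R S, R (R S), …`. -/
def Rit (S : Type u) [SemilatticeSup S] [OrderBot S] : ℕ → SemilatSupCat.{u}
  | 0 => SemilatSupCat.of S
  | n + 1 => SemilatSupCat.of (R (Rit S n))

/-- The canonical maps between the iterates. -/
def Rit.map (S : Type u) [SemilatticeSup S] [OrderBot S] (n m : ℕ) (h : n ≤ m) :
    SupBotHom (Rit S n) (Rit S m) :=
  Nat.leRec (motive := fun m _ => SupBotHom (Rit S n) (Rit S m)) (SupBotHom.id (Rit S n))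
    (fun m _ f => (R.ofHom (Rit S m)).comp f) h

theorem Rit.map_succ (S : Type u) [SemilatticeSup S] [OrderBot S] (n m : ℕ) (h : n ≤ m) :
    Rit.map S n (m + 1) (h.trans m.le_succ) = (R.ofHom (Rit S m)).comp (Rit.map S n m h) :=
  Nat.leRec_succ _ _ _

instance (S : Type u) [SemilatticeSup S] [OrderBot S] :
    DirectedSystem (fun n => Rit S n) (fun n m h => Rit.map S n m h) where
  map_self n x := by
    have : Rit.map S n n le_rfl = SupBotHom.id (Rit S n) := Nat.leRec_self _ _
    rw [this]
    rfl
  map_map k j i hij hjk x := by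
    induction hjk with
    | refl =>
      have : Rit.map S j j le_rfl = SupBotHom.id (Rit S j) := Nat.leRec_self _ _
      rw [this]
      rfl
    | step h ih =>
      rw [Rit.map_succ S _ _ h, Rit.map_succ S _ _ (hij.trans h)]
      exact congrArg (R.ofHom (Rit S _)) ih

/-- The distributive `(∨,0)`-semilattice `D S`, the directed union of the iterates `Rⁿ S`. -/
def D (S : Type u) [SemilatticeSup S] [OrderBot S] : Type u :=
  DirectLimit (fun n => Rit S n) (fun n m h => Rit.map S n m h)

namespace D

variable {S : Type u} [SemilatticeSup S] [OrderBot S]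

/-- The canonical map from the `n`-th iterate to `D S`. -/
def mk (n : ℕ) (x : Rit S n) : D S :=
  Quotient.mk (DirectLimit.setoid (fun n m h => Rit.map S n m h)) ⟨n, x⟩

noncomputable instance : Max (D S) where
  max := DirectLimit.map₂ (fun n m h => Rit.map S n m h) (fun n m h => Rit.map S n m h)
    (fun n m h => Rit.map S n m h) (fun _ x y => x ⊔ y) (fun n m h x y => map_sup (Rit.map S n m h) x y)

theorem mk_sup (n : ℕ) (x y : Rit S n) : mk n x ⊔ mk n y = mk n (x ⊔ y) :=
  DirectLimit.map₂_def (fun n m h => Rit.map S n m h) (fun n m h => Rit.map S n m h)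
    (fun n m h => Rit.map S n m h) (fun _ x y => x ⊔ y) (fun n m h x y => map_sup (Rit.map S n m h) x y)
    n x y

theorem mk_map (n m : ℕ) (h : n ≤ m) (x : Rit S n) : mk m (Rit.map S n m h x) = mk n x :=
  (DirectLimit.eq_of_le (F := fun n => Rit S n) (f := fun n m h => Rit.map S n m h)
    (⟨n, x⟩ : Σ n, Rit S n) m h).symm

/-- The order of `D S` is the one of its join: `x ≤ y` iff `x ⊔ y = y`. -/
noncomputable instance : SemilatticeSup (D S) :=
  SemilatticeSup.mk'
    (fun x y => by
      obtain ⟨n, a, b, rfl, rfl⟩ := DirectLimit.exists_eq_mk₂ (fun n m h => Rit.map S n m h) x y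
      change mk n a ⊔ mk n b = mk n b ⊔ mk n a
      rw [mk_sup, mk_sup, sup_comm])
    (fun x y z => by
      obtain ⟨n, a, b, c, rfl, rfl, rfl⟩ :=
        DirectLimit.exists_eq_mk₃ (fun n m h => Rit.map S n m h) x y z
      change mk n a ⊔ mk n b ⊔ mk n c = mk n a ⊔ (mk n b ⊔ mk n c)
      rw [mk_sup, mk_sup, mk_sup, mk_sup, sup_assoc])
    (fun x => by
      obtain ⟨n, a, rfl⟩ := DirectLimit.exists_eq_mk (fun n m h => Rit.map S n m h) x
      change mk n a ⊔ mk n a = mk n a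
      rw [mk_sup, sup_idem])

instance : OrderBot (D S) where
  bot := mk 0 ⊥
  bot_le x := by
    obtain ⟨n, a, rfl⟩ := DirectLimit.exists_eq_mk (fun n m h => Rit.map S n m h) x
    change mk 0 ⊥ ⊔ mk n a = mk n a
    rw [← mk_map 0 n (Nat.zero_le n), map_bot, mk_sup, bot_sup_eq]

end D

/-! ### The semilattices `𝓛(Ω)` and `𝓖(Ω)` -/

/-- The generators `1` and `a_i^ξ` of `𝓛(Ω)`. -/
inductive LGen (Ω : Type u) : Type u
  | one : LGen Ω
  | a (i : Fin 2) (ξ : Ω) : LGen Ω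

/-- The relations `a_0^ξ ∨ a_1^ξ = 1` of `𝓛(Ω)`. -/
inductive LRel (Ω : Type u) : Set (LGen Ω) → LGen Ω → Prop
  | le_one (i : Fin 2) (ξ : Ω) : LRel Ω {LGen.one} (LGen.a i ξ)
  | one_le (ξ : Ω) : LRel Ω {LGen.a 0 ξ, LGen.a 1 ξ} LGen.one

/-- The `(∨,0)`-semilattice `𝓛(Ω)`. -/
abbrev LSem (Ω : Type u) : Type u := Presented (LRel Ω)

/-- The semilattice `𝓖(Ω) = D(𝓛(Ω))`. -/
abbrev G (Ω : Type u) : Type u := D (LSem Ω)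

/-- The unit `1` of `𝓖(Ω)`. -/
def G.one (Ω : Type u) : G Ω := D.mk 0 (Presented.gen (LRel Ω) LGen.one)

/-! ### The semilattices `Sem(m, Ω)` and the refinement properties -/

/-- The generators `0`, `1`, and `k · ξ`, for `0 ≤ k ≤ m + 1` and `ξ ∈ Ω`, of `Sem(m, Ω)`. -/
inductive SemGen (m : ℕ) (Ω : Type v) : Type v
  | zero : SemGen m Ω
  | one : SemGen m Ω
  | pt (k : Fin (m + 2)) (ξ : Ω) : SemGen m Ω

/-- The relations `0 = 0 · ξ ≤ 1 · ξ ≤ ⋯ ≤ m · ξ ≤ (m + 1) · ξ = 1` of `Sem(m, Ω)`. The rule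
`bot` says that the generator `0` is the least element; this already follows from the other
relations if `Ω` is nonempty, so that then no zero is added to the presented join-semilattice.
For empty `Ω` this yields the two-element chain. -/
inductive SemRel (m : ℕ) (Ω : Type v) : Set (SemGen m Ω) → SemGen m Ω → Prop
  | bot : SemRel m Ω ∅ SemGen.zero
  | pt_zero_le (ξ : Ω) : SemRel m Ω {SemGen.zero} (SemGen.pt 0 ξ)
  | zero_le_pt (ξ : Ω) : SemRel m Ω {SemGen.pt 0 ξ} SemGen.zero
  | step (k : Fin (m + 1)) (ξ : Ω) : SemRel m Ω {SemGen.pt k.succ ξ} (SemGen.pt k.castSucc ξ)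
  | pt_last_le (ξ : Ω) : SemRel m Ω {SemGen.one} (SemGen.pt (Fin.last (m + 1)) ξ)
  | one_le_pt (ξ : Ω) : SemRel m Ω {SemGen.pt (Fin.last (m + 1)) ξ} SemGen.one

/-- The join-semilattice `Sem(m, Ω)`. -/
abbrev Sem (m : ℕ) (Ω : Type v) : Type v := Presented (SemRel m Ω)

namespace Sem

/-- The element `0` of `Sem(m, Ω)`. -/
def zero (m : ℕ) (Ω : Type v) : Sem m Ω := Presented.gen (SemRel m Ω) SemGen.zero

/-- The element `1` of `Sem(m, Ω)`. -/
def one (m : ℕ) (Ω : Type v) : Sem m Ω := Presented.gen (SemRel m Ω) SemGen.one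

/-- The element `k · ξ` of `Sem(m, Ω)`. -/
def pt {m : ℕ} {Ω : Type v} (k : Fin (m + 2)) (ξ : Ω) : Sem m Ω :=
  Presented.gen (SemRel m Ω) (SemGen.pt k ξ)

end Sem

/-- The parity function. -/
def parity (n : ℕ) : Fin 2 := if Even n then 0 else 1

/-- The conditions imposed on the map `c : Sem(m, Ω) × Sem(m, Ω) → S`. -/
structure IsRefinementMap {S : Type u} [SemilatticeSup S] [OrderBot S] {m : ℕ} {Ω : Type v}
    (e : S) (a : Ω → Fin 2 → S) (c : Sem m Ω → Sem m Ω → S) : Prop where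
  eq_zero : ∀ p q, p ≤ q → c p q = ⊥
  triangle : ∀ p q r, c p r ≤ c p q ⊔ c q r
  sup_left : ∀ p q r, c (p ⊔ q) r = c p r ⊔ c q r
  one_zero : c (Sem.one m Ω) (Sem.zero m Ω) = e
  step_le : ∀ (ξ : Ω) (k : Fin (m + 1)),
    c (Sem.pt k.succ ξ) (Sem.pt k.castSucc ξ) ≤ a ξ (parity k)

/-- `S` satisfies the uniform refinement property `CLR(e)`. -/
def CLR {S : Type u} [SemilatticeSup S] [OrderBot S] (e : S) : Prop :=
  ∀ (Ω : Type v) [Nonempty Ω] (a : Ω → Fin 2 → S), (∀ ξ, e ≤ a ξ 0 ⊔ a ξ 1) →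
    ∃ Ωs : ℕ+ → Set Ω, Pairwise (Function.onFun Disjoint Ωs) ∧ (⋃ m, Ωs m) = Set.univ ∧
      ∃ c : ∀ m : ℕ+, Sem m (Ωs m) → Sem m (Ωs m) → S,
        ∀ m : ℕ+, IsRefinementMap e (fun ξ : Ωs m => a ξ) (c m)

/-- `S` satisfies `CLR_m(e)`: in `CLR(e)`, one can always take `Ω_m = Ω`. -/
def CLRm {S : Type u} [SemilatticeSup S] [OrderBot S] (m : ℕ+) (e : S) : Prop :=
  ∀ (Ω : Type v) [Nonempty Ω] (a : Ω → Fin 2 → S), (∀ ξ, e ≤ a ξ 0 ⊔ a ξ 1) →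
    ∃ c : Sem m Ω → Sem m Ω → S, IsRefinementMap e a c

/-! ### Congruences of lattices -/

section Congruences

variable {L : Type u} [Lattice L]

theorem latticeCon_ext {c d : LatticeCon L} (h : c.toSetoid = d.toSetoid) : c = d := by
  cases c
  cases d
  cases h
  rfl

/-- Congruences are ordered by inclusion. -/
instance : PartialOrder (LatticeCon L) where
  le c d := ∀ x y, c.r x y → d.r x y
  le_refl _ _ _ h := h
  le_trans _ _ _ h1 h2 x y h := h2 x y (h1 x y h)
  le_antisymm _ _ h1 h2 := latticeCon_ext (Setoid.ext fun x y => ⟨h1 x y, h2 x y⟩)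

instance : InfSet (LatticeCon L) where
  sInf C :=
    { r := fun x y => ∀ c ∈ C, c.r x y
      iseqv := ⟨fun x c _ => c.refl x, fun h c hc => c.symm (h c hc),
        fun h1 h2 c hc => c.trans (h1 c hc) (h2 c hc)⟩
      inf := fun h1 h2 c hc => c.inf (h1 c hc) (h2 c hc)
      sup := fun h1 h2 c hc => c.sup (h1 c hc) (h2 c hc) }

/-- The complete lattice `Con L`. -/
instance : CompleteLattice (LatticeCon L) :=
  completeLatticeOfInf (LatticeCon L) fun _ =>
    ⟨fun c hc _ _ h => h c hc, fun _ hd x y h c hc => hd hc x y h⟩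

/-- The principal congruence `Θ(x, y)`, the least congruence identifying `x` and `y`. -/
def theta (x y : L) : LatticeCon L := sInf {c | c.r x y}

variable (L) in
/-- `Con_c L`: the finitely generated congruences of `L`, that is, the finite joins of
principal congruences. -/
def Conc : Type u :=
  {c : LatticeCon L // ∃ A : Set (L × L), A.Finite ∧ c = ⨆ p ∈ A, theta p.1 p.2}

instance : PartialOrder (Conc L) :=
  inferInstanceAs (PartialOrder
    {c : LatticeCon L // ∃ A : Set (L × L), A.Finite ∧ c = ⨆ p ∈ A, theta p.1 p.2})

instance : SemilatticeSup (Conc L) where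
  sup c d := ⟨c.1 ⊔ d.1, by
    obtain ⟨A, hA, hc⟩ := c.2
    obtain ⟨B, hB, hd⟩ := d.2
    exact ⟨A ∪ B, hA.union hB, by rw [iSup_union, hc, hd]⟩⟩
  le_sup_left c d := le_sup_left (a := c.1) (b := d.1)
  le_sup_right c d := le_sup_right (a := c.1) (b := d.1)
  sup_le _ _ _ h1 h2 := sup_le (α := LatticeCon L) h1 h2

instance : OrderBot (Conc L) where
  bot := ⟨⊥, ∅, Set.finite_empty, by simp⟩
  bot_le c := bot_le (α := LatticeCon L) (a := c.1)

/-- The principal congruence `Θ(x, y)` as an element of `Con_c L`. -/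
def Conc.principal (x y : L) : Conc L := ⟨theta x y, {(x, y)}, Set.finite_singleton _, by simp⟩

/-- The relational product `c₀ ∘ c₁ ∘ ⋯ ∘ cₘ`, where `cᵢ` is `a` for even `i` and `b` for odd `i`. -/
def altComp (a b : LatticeCon L) : ℕ → L → L → Prop
  | 0 => a.r
  | m + 1 => Relation.Comp (altComp a b m) (if Even (m + 1) then a.r else b.r)

variable (L) in
/-- `PermutableSucc L m`: the lattice `L` has `(m + 1)`-permutable congruences. -/
def PermutableSucc (m : ℕ) : Prop := ∀ a b : LatticeCon L, (a ⊔ b).r = altComp a b m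

end Congruences

end CLP

namespace CLP

/-! ### Closed sets of generators -/

/-! Positive half. Since Θ(x,y) = Θ(x∨y, x∧y), an inequality Θ(x,y) ≤ a₀∨a₁ yields a finite sequence
from x∧y to x∨y alternating between a₀ and a₁. Truncated to the interval and replaced by its partial
joins, it becomes a chain (`altComp.exists_chain`). Chains with the same m, one for each ξ, define a
join-homomorphism φ from Sem(m,Ω) to L, and c(p,q) = Θ(φp∨φq, φq) is the required map
(`exists_isRefinementMap`). Grouping the ξ by m gives the decomposition; permutability gives one m
for all ξ.

Negative half (`not_isRefinementMap`). Suppose c is a refinement map for the a_i^ξ in 𝓖(Ω), with at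
least ℵ_{2^m} indices. Every value of c has finite support, so `exists_free_set` provides 2^m + 1
indices such that the values of c over some of them are supported away from the others. By induction
on k, c(1, ⋁_{ξ∈V} (m+1-k)·ξ) = 0 for each set V of 2^k of these indices. For the inductive step,
split V into halves, take a spare index ξ, and cut c(1, x₀∨x₁) along the chain of ξ
(`IsRefinementMap.erosion`): it lies below y₀∨y₁ with y_j below both a_j^ξ and c(1,x_j). By
induction c(1,x_j) lies below a join of generators indexed by one half, and `G.evaporation` forces
zero. At k = m this puts 1 below a finite join of elements a_0^ξ, which is absurd.

Evaporation is immediate in 𝓛(Ω) and climbs through the iterates of R by `Evaporates.free`, with the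
help of `Cancels.free`. Both bound a join in a presented semilattice by exhibiting a set of
generators closed under the rules. -/

theorem cl_subset_of_closed {X : Type u} {r : Set X → X → Prop} {A C : Set X} (h : A ⊆ C)
    (hC : ∀ P x, r P x → P ⊆ C → x ∈ C) : cl r A ⊆ C := by
  intro x hx
  induction hx with
  | mem hx => exact h hx
  | rule hr _ ih => exact hC _ _ hr ih

namespace Presented

variable {X : Type u} {r : Set X → X → Prop}

theorem rule_mem (I : Presented r) {P : Set X} {x : X} (hr : r P x) (hP : P ⊆ I.1) : x ∈ I.1 :=
  I.mem_of_derives (Derives.rule hr fun p hp => Derives.mem (hP hp))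

theorem sup_subset_of_closed {I J : Presented r} {C : Set X} (hI : I.1 ⊆ C) (hJ : J.1 ⊆ C)
    (hC : ∀ P x, r P x → P ⊆ C → x ∈ C) : (I ⊔ J).1 ⊆ C :=
  cl_subset_of_closed (Set.union_subset hI hJ) hC

theorem gen_subset_of_closed {x : X} {C : Set X} (hx : x ∈ C)
    (hC : ∀ P x, r P x → P ⊆ C → x ∈ C) : (gen r x).1 ⊆ C :=
  cl_subset_of_closed (Set.singleton_subset_iff.2 hx) hC

theorem le_of_cl_subset {I J : Presented r} {A : Set X} (hI : I.1 = cl r A) (h : A ⊆ J.1) :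
    I ≤ J := by
  change I.1 ⊆ J.1
  rw [hI]
  exact cl_subset_of_closed h fun P x hr hP => J.rule_mem hr hP

theorem mem_gen (x : X) : x ∈ (gen r x).1 := subset_cl r {x} rfl

/-- A map on generators that respects the rules extends to a join-homomorphism. -/
theorem exists_extension {T : Type v} [SemilatticeSup T] [OrderBot T] (f : X → T)
    (hf : ∀ P x, r P x → ∀ t, (∀ p ∈ P, f p ≤ t) → f x ≤ t) :
    ∃ φ : Presented r → T, (∀ I J, φ (I ⊔ J) = φ I ⊔ φ J) ∧ ∀ x, φ (gen r x) = f x := by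
  have key : ∀ (A : Set X) (t : T), (∀ x ∈ A, f x ≤ t) → ∀ x ∈ cl r A, f x ≤ t :=
    fun A t h => cl_subset_of_closed (C := {x | f x ≤ t}) h fun P x hr hP => hf P x hr t hP
  -- The extension sends I to the supremum of f over I, which exists because a finite generating set
  -- already attains it.
  have hlub : ∀ I : Presented r, ∃ t, IsLUB (f '' I.1) t := by
    rintro ⟨I, A, hA, rfl⟩
    refine ⟨hA.toFinset.sup f, ?_, ?_⟩
    · rintro _ ⟨x, hx, rfl⟩
      exact key A _ (fun y hy => Finset.le_sup (f := f) (hA.mem_toFinset.2 hy)) x hx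
    · intro t ht
      refine Finset.sup_le fun y hy => ht ⟨y, subset_cl r A (hA.mem_toFinset.1 hy), rfl⟩
  choose φ hφ using hlub
  refine ⟨φ, fun I J => (hφ (I ⊔ J)).unique ⟨?_, ?_⟩, fun x => (hφ _).unique ⟨?_, ?_⟩⟩
  · rintro _ ⟨x, hx, rfl⟩
    refine key _ _ ?_ x hx
    rintro y (hy | hy)
    · exact ((hφ I).1 ⟨y, hy, rfl⟩).trans le_sup_left
    · exact ((hφ J).1 ⟨y, hy, rfl⟩).trans le_sup_right
  · intro t ht
    refine sup_le ((hφ I).2 ?_) ((hφ J).2 ?_)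
    · rintro _ ⟨y, hy, rfl⟩
      exact ht ⟨y, (le_sup_left : I ≤ I ⊔ J) hy, rfl⟩
    · rintro _ ⟨y, hy, rfl⟩
      exact ht ⟨y, (le_sup_right : J ≤ I ⊔ J) hy, rfl⟩
  · rintro _ ⟨y, hy, rfl⟩
    exact key _ _ (by rintro z rfl; exact le_rfl) y hy
  · intro t ht
    exact ht ⟨x, mem_gen x, rfl⟩

end Presented

/-! ### The order of the free distributive extension -/

section FreeExtension

variable {S : Type u} [SemilatticeSup S] [OrderBot S]

/-- A set of generators of `R S` described by an ideal `Q` of `S` and a set `B` of new generators. -/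
def RGen.extend (Q : S → Prop) (B : Set (RGen S)) : Set (RGen S)
  | RGen.of t => Q t
  | RGen.bow a b c h => Q a ∨ Q c ∨ RGen.bow a b c h ∈ B

/-- Only the rule splitting c into two new generators can leave such a set. When both halves are
present because of Q alone, the ideal property gives c; otherwise one half comes from B, and `hB` is
what remains to be checked. -/
theorem RGen.extend_closed {Q : S → Prop} {B : Set (RGen S)} (hbot : Q ⊥)
    (hsup : ∀ a b c, Q a → Q b → c ≤ a ⊔ b → Q c)
    (hB : ∀ a b c h h', RGen.bow a b c h ∈ B → Q b ∨ RGen.bow b a c h' ∈ B → Q c) :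
    ∀ P x, RRel S P x → P ⊆ RGen.extend Q B → x ∈ RGen.extend Q B := by
  intro P x hr hP
  cases hr with
  | zero => exact hbot
  | join a b c h =>
    exact hsup a b c (hP (Set.mem_insert _ _)) (hP (Set.mem_insert_of_mem _ rfl)) h
  | bow_le_left a b c h => exact Or.inl (hP (Set.mem_singleton _))
  | bow_le a b c h => exact Or.inr (Or.inl (hP (Set.mem_singleton _)))
  | le_bow a b c h h' =>
    change Q c
    rcases (hP (Set.mem_insert _ _) : Q a ∨ Q c ∨ _) with h1 | h1 | h1
    · rcases (hP (Set.mem_insert_of_mem _ rfl) : Q b ∨ Q c ∨ _) with h2 | h2 | h2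
      · exact hsup a b c h1 h2 h
      · exact h2
      · exact hB b a c h' h h2 (Or.inl h1)
    · exact h1
    · rcases (hP (Set.mem_insert_of_mem _ rfl) : Q b ∨ Q c ∨ _) with h2 | h2 | h2
      · exact hB a b c h h' h1 (Or.inl h2)
      · exact h2
      · exact hB a b c h h' h1 (Or.inr h2)

namespace R

theorem of_mem_of_le {x : R S} {s t : S} (hs : RGen.of s ∈ x.1) (h : t ≤ s) : RGen.of t ∈ x.1 := by
  refine x.rule_mem (RRel.join s s t (by simpa using h)) ?_
  rintro _ (rfl | rfl) <;> exact hs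

theorem of_mem_of_le_sup {x : R S} {a b c : S} (ha : RGen.of a ∈ x.1) (hb : RGen.of b ∈ x.1)
    (h : c ≤ a ⊔ b) : RGen.of c ∈ x.1 := by
  refine x.rule_mem (RRel.join a b c h) ?_
  rintro _ (rfl | rfl) <;> assumption

theorem of_bot_mem (x : R S) : RGen.of ⊥ ∈ x.1 := x.rule_mem RRel.zero (Set.empty_subset _)

theorem bow_mem_of_left {x : R S} {a b c : S} {h : c ≤ a ⊔ b} (ha : RGen.of a ∈ x.1) :
    RGen.bow a b c h ∈ x.1 :=
  x.rule_mem (RRel.bow_le_left a b c h) (Set.singleton_subset_iff.2 ha)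

theorem bow_mem_of_right {x : R S} {a b c : S} {h : c ≤ a ⊔ b} (hc : RGen.of c ∈ x.1) :
    RGen.bow a b c h ∈ x.1 :=
  x.rule_mem (RRel.bow_le a b c h) (Set.singleton_subset_iff.2 hc)

theorem of_mem_of_bow {x : R S} {a b c : S} {h : c ≤ a ⊔ b} {h' : c ≤ b ⊔ a}
    (h1 : RGen.bow a b c h ∈ x.1) (h2 : RGen.bow b a c h' ∈ x.1) : RGen.of c ∈ x.1 := by
  refine x.rule_mem (RRel.le_bow a b c h h') ?_
  rintro _ (rfl | rfl) <;> assumption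

/-- With B empty the set is already closed: below an old element d the only new generators are those
with a ≤ d or c ≤ d. It follows that S embeds in R S. -/
theorem ofHom_subset (d : S) : (R.ofHom S d).1 ⊆ RGen.extend (· ≤ d) ∅ :=
  Presented.gen_subset_of_closed (le_refl d) (RGen.extend_closed bot_le
    (fun _ _ _ ha hb hc => hc.trans (sup_le ha hb)) fun _ _ _ _ _ h => h.elim)

theorem of_mem_ofHom {t d : S} : RGen.of t ∈ (R.ofHom S d).1 ↔ t ≤ d :=
  ⟨fun h => ofHom_subset d h, fun h => of_mem_of_le (Presented.mem_gen _) h⟩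

theorem bow_mem_ofHom {a b c d : S} {h : c ≤ a ⊔ b} (hm : RGen.bow a b c h ∈ (R.ofHom S d).1) :
    a ≤ d ∨ c ≤ d := by
  rcases ofHom_subset d hm with h | h | h
  · exact Or.inl h
  · exact Or.inr h
  · exact h.elim

theorem ofHom_le_iff {t : S} {x : R S} : R.ofHom S t ≤ x ↔ RGen.of t ∈ x.1 :=
  Presented.gen_le_iff

theorem ofHom_le_ofHom {s t : S} : R.ofHom S s ≤ R.ofHom S t ↔ s ≤ t :=
  ofHom_le_iff.trans of_mem_ofHom

end R

/-! ### Subsemilattices of the free distributive extension -/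

/-- `P` is a `(∨,0)`-subsemilattice. -/
structure IsSub (P : Set S) : Prop where
  bot_mem : ⊥ ∈ P
  sup_mem : ∀ {a b}, a ∈ P → b ∈ P → a ⊔ b ∈ P

theorem IsSub.finset_sup_mem {P : Set S} (hP : IsSub P) {ι : Type*} (s : Finset ι) (f : ι → S)
    (h : ∀ i ∈ s, f i ∈ P) : s.sup f ∈ P :=
  Finset.sup_induction hP.bot_mem (fun _ ha _ hb => hP.sup_mem ha hb) h

/-- The generators of `R S` with all entries in `P`. -/
def RGen.over (P : Set S) : Set (RGen S)
  | RGen.of t => t ∈ P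
  | RGen.bow a b c _ => a ∈ P ∧ b ∈ P ∧ c ∈ P

/-- The subsemilattice of `R S` generated by the generators with all entries in `P`. -/
def Rsub (P : Set S) : Set (R S) := {x | ∃ A ⊆ RGen.over P, x.1 = cl (RRel S) A}

theorem Rsub.isSub (P : Set S) : IsSub (Rsub P) where
  bot_mem := ⟨∅, Set.empty_subset _, rfl⟩
  sup_mem := by
    rintro a b ⟨A, hA, ha⟩ ⟨B, hB, hb⟩
    refine ⟨A ∪ B, Set.union_subset hA hB, ?_⟩
    change cl _ (a.1 ∪ b.1) = _
    rw [ha, hb]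
    refine Set.Subset.antisymm (cl_subset (Set.union_subset ?_ ?_)) (cl_mono ?_)
    · exact cl_mono Set.subset_union_left
    · exact cl_mono Set.subset_union_right
    · exact Set.union_subset_union (subset_cl _ A) (subset_cl _ B)

theorem Rsub.ofHom_mem {P : Set S} {s : S} (hs : s ∈ P) : R.ofHom S s ∈ Rsub P :=
  ⟨{RGen.of s}, Set.singleton_subset_iff.2 hs, rfl⟩

theorem Rsub.mono {P Q : Set S} (h : P ⊆ Q) : Rsub P ⊆ Rsub Q := by
  rintro x ⟨A, hA, hx⟩
  refine ⟨A, fun g hg => ?_, hx⟩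
  have := hA hg
  cases g with
  | of t => exact h this
  | bow a b c _ => exact ⟨h this.1, h this.2.1, h this.2.2⟩

/-- An element generated over P has a normal form: its old generators lie below ones in P, and its
new generators are either forced by old ones or belong to the generating set. The two lemmas that
follow are the form in which this is used. -/
theorem Rsub.subset {P : Set S} (hP : IsSub P) {x : R S} {A : Set (RGen S)}
    (hA : A ⊆ RGen.over P) (hx : x.1 = cl (RRel S) A) :
    x.1 ⊆ RGen.extend (fun t => ∃ s ∈ P, RGen.of s ∈ x.1 ∧ t ≤ s) A := by
  have hAx : A ⊆ x.1 := hx ▸ subset_cl _ A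
  intro g hg
  rw [hx] at hg
  revert g
  refine cl_subset_of_closed ?_ (RGen.extend_closed ?_ ?_ ?_)
  · intro g hg
    cases g with
    | of t => exact ⟨t, hA hg, hAx hg, le_rfl⟩
    | bow a b c h => exact Or.inr (Or.inr hg)
  · exact ⟨⊥, hP.bot_mem, R.of_bot_mem x, le_rfl⟩
  · rintro a b c ⟨s, hs, hsx, has⟩ ⟨t, ht, htx, hbt⟩ hc
    exact ⟨s ⊔ t, hP.sup_mem hs ht, R.of_mem_of_le_sup hsx htx le_rfl, hc.trans (sup_le_sup has hbt)⟩
  · rintro a b c h h' h1 h2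
    refine ⟨c, (hA h1).2.2, ?_, le_rfl⟩
    rcases h2 with ⟨s, -, hsx, hbs⟩ | h2
    · exact R.of_mem_of_bow (hAx h1) (R.bow_mem_of_left (h := h') (R.of_mem_of_le hsx hbs))
    · exact R.of_mem_of_bow (hAx h1) (hAx h2)

theorem Rsub.exists_of_mem {P : Set S} (hP : IsSub P) {x : R S} (hx : x ∈ Rsub P) {t : S}
    (ht : RGen.of t ∈ x.1) : ∃ s ∈ P, RGen.of s ∈ x.1 ∧ t ≤ s := by
  obtain ⟨A, hA, hx⟩ := hx
  exact Rsub.subset hP hA hx ht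

theorem Rsub.bow_mem {P : Set S} (hP : IsSub P) {x : R S} (hx : x ∈ Rsub P) {a b c : S}
    {h : c ≤ a ⊔ b} (hm : RGen.bow a b c h ∈ x.1) :
    RGen.of a ∈ x.1 ∨ RGen.of c ∈ x.1 ∨ (a ∈ P ∧ b ∈ P ∧ c ∈ P) := by
  obtain ⟨A, hA, hx⟩ := hx
  rcases Rsub.subset hP hA hx hm with ⟨s, -, hs, h1⟩ | ⟨s, -, hs, h1⟩ | h1
  · exact Or.inl (R.of_mem_of_le hs h1)
  · exact Or.inr (Or.inl (R.of_mem_of_le hs h1))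
  · exact Or.inr (Or.inr (hA h1))

/-- Every element of `R S` lies over some member of a directed covering family. -/
theorem Rsub.exists_mem {ι : Type v} [SemilatticeSup ι] [Nonempty ι] {P : ι → Set S}
    (hmono : Monotone P) (hcov : ∀ s, ∃ i, s ∈ P i) (x : R S) : ∃ i, x ∈ Rsub (P i) := by
  have hgen : ∀ g : RGen S, ∃ i, g ∈ RGen.over (P i) := by
    rintro (t | ⟨a, b, c, h⟩)
    · exact hcov t
    · obtain ⟨i, hi⟩ := hcov a
      obtain ⟨j, hj⟩ := hcov b
      obtain ⟨k, hk⟩ := hcov c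
      exact ⟨i ⊔ j ⊔ k, hmono (le_sup_left.trans le_sup_left) hi,
        hmono (le_sup_right.trans le_sup_left) hj, hmono le_sup_right hk⟩
  obtain ⟨A, hA, hx⟩ := x.2
  choose i hi using hgen
  obtain ⟨k, hk⟩ := (hA.image i).bddAbove
  refine ⟨k, A, fun g hg => ?_, hx⟩
  have hik := hmono (hk ⟨g, hg, rfl⟩)
  have hg' := hi g
  cases g with
  | of t => exact hik hg'
  | bow a b c h => exact ⟨hik hg'.1, hik hg'.2.1, hik hg'.2.2⟩

/-! ### Cancellation and evaporation -/

/-- The element `w` can be cancelled in inequalities between elements of `P`. -/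
def Cancels (P : Set S) (w : S) : Prop := ∀ p ∈ P, ∀ s ∈ P, p ≤ s ⊔ w → p ≤ s

theorem Cancels.eq_bot {P : Set S} (hP : IsSub P) {w : S} (h : Cancels P w) {p : S} (hp : p ∈ P)
    (hw : p ≤ w) : p = ⊥ :=
  le_bot_iff.1 (h p hp ⊥ hP.bot_mem (by simpa using hw))

/-- The generators below s ∨ w are controlled by the ideal of all t ≤ s' ∨ w, with s' in P and below
s, together with the generators of s. A new generator of s over P cannot interact with w: if its
partner is absorbed because b ≤ s' ∨ w, cancelling in S gives b ≤ s', so the partner was already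
below s. -/
theorem Cancels.free {P : Set S} (hP : IsSub P) {w : S} (hw : Cancels P w) :
    Cancels (Rsub P) (R.ofHom S w) := by
  rintro p ⟨A, hA, hp⟩ s hs hle
  have hof : ∀ t, RGen.of t ∈ s.1 → ∃ s' ∈ P, RGen.of s' ∈ s.1 ∧ t ≤ s' ⊔ w := fun t ht => by
    obtain ⟨s', h1, h2, h3⟩ := Rsub.exists_of_mem hP hs ht
    exact ⟨s', h1, h2, h3.trans le_sup_left⟩
  have hsup : ∀ a b c, (∃ s' ∈ P, RGen.of s' ∈ s.1 ∧ a ≤ s' ⊔ w) →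
      (∃ s' ∈ P, RGen.of s' ∈ s.1 ∧ b ≤ s' ⊔ w) → c ≤ a ⊔ b →
      ∃ s' ∈ P, RGen.of s' ∈ s.1 ∧ c ≤ s' ⊔ w := by
    rintro a b c ⟨s1, h1, h2, h3⟩ ⟨s2, h4, h5, h6⟩ hc
    refine ⟨s1 ⊔ s2, hP.sup_mem h1 h4, R.of_mem_of_le_sup h2 h5 le_rfl, hc.trans (sup_le ?_ ?_)⟩
    · exact h3.trans (sup_le_sup_right le_sup_left w)
    · exact h6.trans (sup_le_sup_right le_sup_right w)
  have key : (s ⊔ R.ofHom S w).1 ⊆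
      RGen.extend (fun t => ∃ s' ∈ P, RGen.of s' ∈ s.1 ∧ t ≤ s' ⊔ w) s.1 := by
    have hclosed := RGen.extend_closed (Q := fun t => ∃ s' ∈ P, RGen.of s' ∈ s.1 ∧ t ≤ s' ⊔ w)
      (B := s.1) ⟨⊥, hP.bot_mem, R.of_bot_mem s, bot_le⟩ hsup ?_
    · refine Presented.sup_subset_of_closed ?_ (Presented.gen_subset_of_closed ?_ hclosed) hclosed
      · intro g hg
        cases g with
        | of t => exact hof t hg
        | bow a b c h => exact Or.inr (Or.inr hg)
      · exact ⟨⊥, hP.bot_mem, R.of_bot_mem s, le_sup_right⟩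
    · rintro a b c h h' h1 (hb | h2)
      · rcases Rsub.bow_mem hP hs h1 with ha | hc | ⟨-, hbP, -⟩
        · exact hsup a b c (hof a ha) hb h
        · exact hof c hc
        · obtain ⟨s', hs'P, hs', hle'⟩ := hb
          have hbs := R.of_mem_of_le hs' (hw b hbP s' hs'P hle')
          exact hof c (R.of_mem_of_bow h1 (R.bow_mem_of_left (h := h') hbs))
      · exact hof c (R.of_mem_of_bow h1 h2)
  refine Presented.le_of_cl_subset hp fun g hg => ?_
  -- Elements of the ideal that lie in P are below s, again by cancellation.
  have hQ : ∀ t ∈ P, (∃ s' ∈ P, RGen.of s' ∈ s.1 ∧ t ≤ s' ⊔ w) → RGen.of t ∈ s.1 := by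
    rintro t ht ⟨s', h1, h2, h3⟩
    exact R.of_mem_of_le h2 (hw t ht s' h1 h3)
  have hg1 := key (hle (hp ▸ subset_cl _ A hg))
  have hg2 := hA hg
  cases g with
  | of t => exact hQ t hg2 hg1
  | bow a b c h =>
    rcases hg1 with h1 | h1 | h1
    · exact R.bow_mem_of_left (hQ a hg2.1 h1)
    · exact R.bow_mem_of_right (hQ c hg2.2.2 h1)
    · exact h1

/-- An element of `P` below a join of two elements of `P₀` and `P₁`, the first below `d₀` and `w₀`,
the second below `d₁` and `w₁`, is zero. -/
def Evaporates (P P₀ P₁ : Set S) (d₀ d₁ w₀ w₁ : S) : Prop :=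
  ∀ x ∈ P₀, ∀ y ∈ P₁, ∀ z ∈ P, x ≤ d₀ → x ≤ w₀ → y ≤ d₁ → y ≤ w₁ → z ≤ x ⊔ y → z = ⊥

/-- The join x ∨ y is controlled by the ideal `Q` generated by the old elements of P₀ below x and of
P₁ below y, together with the new generators of x and of y. Cancelling w₁ over P₀ and w₀ over P₁
shows that no rule produces anything else. The bounds d₀ and d₁, cancellable over P, then remove the
new generators over P. -/
theorem Evaporates.free {P P₀ P₁ : Set S} {d₀ d₁ w₀ w₁ : S} (H : Evaporates P P₀ P₁ d₀ d₁ w₀ w₁)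
    (hP : IsSub P) (hP₀ : IsSub P₀) (hP₁ : IsSub P₁) (hd₀ : Cancels P d₀) (hd₁ : Cancels P d₁)
    (hw₁ : Cancels P₀ w₁) (hw₀ : Cancels P₁ w₀) :
    Evaporates (Rsub P) (Rsub P₀) (Rsub P₁) (R.ofHom S d₀) (R.ofHom S d₁) (R.ofHom S w₀)
      (R.ofHom S w₁) := by
  rintro x hx y hy z ⟨A, hA, hz⟩ hxd hxw hyd hyw hle
  set Q : S → Prop := fun t => ∃ s ∈ P₀, RGen.of s ∈ x.1 ∧ ∃ s' ∈ P₁, RGen.of s' ∈ y.1 ∧ t ≤ s ⊔ s'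
    with hQ
  have hQbot : Q ⊥ := ⟨⊥, hP₀.bot_mem, R.of_bot_mem x, ⊥, hP₁.bot_mem, R.of_bot_mem y, bot_le⟩
  have hQx : ∀ t, RGen.of t ∈ x.1 → Q t := fun t ht => by
    obtain ⟨s, h1, h2, h3⟩ := Rsub.exists_of_mem hP₀ hx ht
    exact ⟨s, h1, h2, ⊥, hP₁.bot_mem, R.of_bot_mem y, h3.trans le_sup_left⟩
  have hQy : ∀ t, RGen.of t ∈ y.1 → Q t := fun t ht => by
    obtain ⟨s, h1, h2, h3⟩ := Rsub.exists_of_mem hP₁ hy ht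
    exact ⟨⊥, hP₀.bot_mem, R.of_bot_mem x, s, h1, h2, h3.trans le_sup_right⟩
  have hsup : ∀ a b c, Q a → Q b → c ≤ a ⊔ b → Q c := by
    rintro a b c ⟨s, h1, h2, s', h3, h4, h5⟩ ⟨t, k1, k2, t', k3, k4, k5⟩ hc
    refine ⟨s ⊔ t, hP₀.sup_mem h1 k1, R.of_mem_of_le_sup h2 k2 le_rfl, s' ⊔ t', hP₁.sup_mem h3 k3,
      R.of_mem_of_le_sup h4 k4 le_rfl, hc.trans (sup_le ?_ ?_)⟩
    · exact h5.trans (sup_le_sup le_sup_left le_sup_left)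
    · exact k5.trans (sup_le_sup le_sup_right le_sup_right)
  -- The part of b coming from y is below w₁, which cancels over P₀; so b is below x and both halves
  -- of c are.
  have hBx : ∀ a b c h, (h' : c ≤ b ⊔ a) → RGen.bow a b c h ∈ x.1 → Q b → Q c := by
    rintro a b c h h' h1 hb
    rcases Rsub.bow_mem hP₀ hx h1 with ha | hc | ⟨-, hbP, -⟩
    · exact hsup a b c (hQx a ha) hb h
    · exact hQx c hc
    · obtain ⟨s, hsP, hs, s', -, hs', hbs⟩ := hb
      have hs'w : s' ≤ w₁ := R.of_mem_ofHom.1 (hyw hs')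
      have hbx := R.of_mem_of_le hs (hw₁ b hbP s hsP (hbs.trans (sup_le_sup_left hs'w s)))
      exact hQx c (R.of_mem_of_bow h1 (R.bow_mem_of_left (h := h') hbx))
  have hBy : ∀ a b c h, (h' : c ≤ b ⊔ a) → RGen.bow a b c h ∈ y.1 → Q b → Q c := by
    rintro a b c h h' h1 hb
    rcases Rsub.bow_mem hP₁ hy h1 with ha | hc | ⟨-, hbP, -⟩
    · exact hsup a b c (hQy a ha) hb h
    · exact hQy c hc
    · obtain ⟨s, -, hs, s', hs'P, hs', hbs⟩ := hb
      have hsw : s ≤ w₀ := R.of_mem_ofHom.1 (hxw hs)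
      have hby := R.of_mem_of_le hs' (hw₀ b hbP s' hs'P
        (hbs.trans (sup_comm s s' ▸ sup_le_sup_left hsw s')))
      exact hQy c (R.of_mem_of_bow h1 (R.bow_mem_of_left (h := h') hby))
  -- Two matching halves, one from each side, have all their entries in both P₀ and P₁. The bounds
  -- w₀ and w₁ then annihilate c, or else both a and b and hence c.
  have hBxy : ∀ a b c h h', RGen.bow a b c h ∈ x.1 → RGen.bow b a c h' ∈ y.1 → Q c := by
    rintro a b c h h' h1 h2
    rcases Rsub.bow_mem hP₀ hx h1 with ha | hc | ⟨-, hb₀, hc₀⟩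
    · exact hBy b a c h' h h2 (hQx a ha)
    · exact hQx c hc
    rcases Rsub.bow_mem hP₁ hy h2 with hb | hc | ⟨-, ha₁, hc₁⟩
    · exact hBx a b c h h' h1 (hQy b hb)
    · exact hQy c hc
    suffices c = ⊥ from this ▸ hQbot
    rcases R.bow_mem_ofHom (hxw h1) with ha | hc
    · rcases R.bow_mem_ofHom (hyw h2) with hb | hc
      · rw [hw₀.eq_bot hP₁ ha₁ ha, hw₁.eq_bot hP₀ hb₀ hb] at h
        simpa using h
      · exact hw₁.eq_bot hP₀ hc₀ hc
    · exact hw₀.eq_bot hP₁ hc₁ hc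
  have hclosed := RGen.extend_closed (Q := Q) (B := x.1 ∪ y.1) hQbot hsup (by
    rintro a b c h h' (h1 | h1) (hb | h2 | h2)
    · exact hBx a b c h h' h1 hb
    · exact hQx c (R.of_mem_of_bow h1 h2)
    · exact hBxy a b c h h' h1 h2
    · exact hBy a b c h h' h1 hb
    · exact hBxy b a c h' h h2 h1
    · exact hQy c (R.of_mem_of_bow h1 h2))
  have key : (x ⊔ y).1 ⊆ RGen.extend Q (x.1 ∪ y.1) := by
    refine Presented.sup_subset_of_closed ?_ ?_ hclosed
    · intro g hg
      cases g with
      | of t => exact hQx t hg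
      | bow a b c h => exact Or.inr (Or.inr (Or.inl hg))
    · intro g hg
      cases g with
      | of t => exact hQy t hg
      | bow a b c h => exact Or.inr (Or.inr (Or.inr hg))
  have hQP : ∀ t ∈ P, Q t → t = ⊥ := by
    rintro t ht ⟨s, h1, h2, s', h3, h4, h5⟩
    exact H s h1 s' h3 t ht (R.of_mem_ofHom.1 (hxd h2)) (R.of_mem_ofHom.1 (hxw h2))
      (R.of_mem_ofHom.1 (hyd h4)) (R.of_mem_ofHom.1 (hyw h4)) h5
  refine le_bot_iff.1 (Presented.le_of_cl_subset hz fun g hg => ?_)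
  have hg1 := key (hle (hz ▸ subset_cl _ A hg))
  have hg2 := hA hg
  cases g with
  | of t =>
    rw [hQP t hg2 hg1]
    exact R.of_bot_mem _
  | bow a b c h =>
    -- A new generator below d₀ or d₁ has a or c below that element, hence zero by cancellation over
    -- P.
    have hac : a = ⊥ ∨ c = ⊥ := by
      rcases hg1 with h1 | h1 | h1 | h1
      · exact Or.inl (hQP a hg2.1 h1)
      · exact Or.inr (hQP c hg2.2.2 h1)
      · exact (R.bow_mem_ofHom (hxd h1)).imp (hd₀.eq_bot hP hg2.1) (hd₀.eq_bot hP hg2.2.2)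
      · exact (R.bow_mem_ofHom (hyd h1)).imp (hd₁.eq_bot hP hg2.1) (hd₁.eq_bot hP hg2.2.2)
    rcases hac with rfl | rfl
    · exact R.bow_mem_of_left (R.of_bot_mem _)
    · exact R.bow_mem_of_right (R.of_bot_mem _)

end FreeExtension

/-! ### The iterates and their union -/

section Iterates

variable {S : Type u} [SemilatticeSup S] [OrderBot S]

/-- The subsemilattices of the iterates generated by `P`. -/
def Ritsub (P : Set S) : ∀ n, Set (Rit S n)
  | 0 => P
  | n + 1 => Rsub (Ritsub P n)

theorem Rit.map_self (n : ℕ) (x : Rit S n) : Rit.map S n n le_rfl x = x :=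
  DirectedSystem.map_self (f := fun n m h => Rit.map S n m h) x

theorem Rit.map_le_map {n m : ℕ} (h : n ≤ m) {x y : Rit S n} :
    Rit.map S n m h x ≤ Rit.map S n m h y ↔ x ≤ y := by
  induction h with
  | refl => rw [Rit.map_self, Rit.map_self]
  | step h ih =>
    rw [Rit.map_succ S _ _ h]
    exact R.ofHom_le_ofHom.trans ih

theorem Rit.map_injective {n m : ℕ} (h : n ≤ m) : Function.Injective (Rit.map S n m h) :=
  fun _ _ hxy => le_antisymm ((Rit.map_le_map h).1 hxy.le) ((Rit.map_le_map h).1 hxy.ge)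

theorem Ritsub.isSub {P : Set S} (hP : IsSub P) : ∀ n, IsSub (Ritsub P n)
  | 0 => hP
  | _ + 1 => Rsub.isSub _

theorem Ritsub.mono {P Q : Set S} (h : P ⊆ Q) : ∀ n, Ritsub P n ⊆ Ritsub Q n
  | 0 => h
  | n + 1 => Rsub.mono (Ritsub.mono h n)

theorem Ritsub.map_mem {P : Set S} {n m : ℕ} (h : n ≤ m) {x : Rit S n} (hx : x ∈ Ritsub P n) :
    Rit.map S n m h x ∈ Ritsub P m := by
  induction h with
  | refl => rwa [Rit.map_self]
  | step h ih =>
    rw [Rit.map_succ S _ _ h]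
    exact Rsub.ofHom_mem ih

theorem Ritsub.exists_mem {ι : Type v} [SemilatticeSup ι] [Nonempty ι] {P : ι → Set S}
    (hmono : Monotone P) (hcov : ∀ s, ∃ i, s ∈ P i) : ∀ n (x : Rit S n), ∃ i, x ∈ Ritsub (P i) n
  | 0 => hcov
  | n + 1 => Rsub.exists_mem (fun _ _ h => Ritsub.mono (hmono h) n)
      (Ritsub.exists_mem hmono hcov n)

/-- The canonical map from `S` to its iterates. -/
def Rit.ofBase (n : ℕ) (s : S) : Rit S n := Rit.map S 0 n n.zero_le s

theorem Rit.ofBase_zero (s : S) : Rit.ofBase 0 s = s := Rit.map_self 0 s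

theorem Rit.ofBase_succ (n : ℕ) (s : S) :
    Rit.ofBase (n + 1) s = R.ofHom (Rit S n) (Rit.ofBase n s) := by
  unfold Rit.ofBase
  rw [Rit.map_succ S 0 n n.zero_le]
  rfl

theorem Cancels.iterate {P : Set S} (hP : IsSub P) {w : S} (h : Cancels P w) :
    ∀ n, Cancels (Ritsub P n) (Rit.ofBase n w)
  | 0 => (Rit.ofBase_zero w).symm ▸ h
  | n + 1 => (Rit.ofBase_succ n w).symm ▸ (h.iterate hP n).free (Ritsub.isSub hP n)

theorem Evaporates.iterate {P P₀ P₁ : Set S} {d₀ d₁ w₀ w₁ : S}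
    (H : Evaporates P P₀ P₁ d₀ d₁ w₀ w₁)
    (hP : IsSub P) (hP₀ : IsSub P₀) (hP₁ : IsSub P₁) (hd₀ : Cancels P d₀) (hd₁ : Cancels P d₁)
    (hw₁ : Cancels P₀ w₁) (hw₀ : Cancels P₁ w₀) (n : ℕ) :
    Evaporates (Ritsub P n) (Ritsub P₀ n) (Ritsub P₁ n) (Rit.ofBase n d₀) (Rit.ofBase n d₁)
      (Rit.ofBase n w₀) (Rit.ofBase n w₁) := by
  induction n with
  | zero =>
    rw [Rit.ofBase_zero, Rit.ofBase_zero, Rit.ofBase_zero, Rit.ofBase_zero]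
    exact H
  | succ n ih =>
    rw [Rit.ofBase_succ, Rit.ofBase_succ, Rit.ofBase_succ, Rit.ofBase_succ]
    exact ih.free (Ritsub.isSub hP n) (Ritsub.isSub hP₀ n) (Ritsub.isSub hP₁ n)
      (hd₀.iterate hP n) (hd₁.iterate hP n) (hw₁.iterate hP₀ n) (hw₀.iterate hP₁ n)

namespace D

theorem exists_eq_mk (x : D S) : ∃ n a, x = mk n a :=
  DirectLimit.exists_eq_mk (fun n m h => Rit.map S n m h) x

/-- The connecting maps are order embeddings, so nothing is identified in the union and inequalities
can be tested at any finite level. -/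
theorem mk_injective (n : ℕ) : Function.Injective (mk (S := S) n) := by
  intro x y hxy
  obtain ⟨k, h1, h2, h⟩ := Quotient.exact hxy
  exact Rit.map_injective _ h

/-- The join of `D S`, seen as the one of its semilattice structure. -/
noncomputable instance semilatticeMax : Max (D S) := SemilatticeSup.toMax

theorem mk_sup_mk (n : ℕ) (x y : Rit S n) : mk n x ⊔ mk n y = mk n (x ⊔ y) := mk_sup n x y

theorem mk_le_mk {n : ℕ} {x y : Rit S n} : mk n x ≤ mk n y ↔ x ≤ y := by
  rw [← sup_eq_right, mk_sup_mk, (mk_injective n).eq_iff, sup_eq_right]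

/-- The canonical map from `S` to `D S`. -/
def ofBase (s : S) : D S := mk 0 s

theorem ofBase_eq_mk (n : ℕ) (s : S) : ofBase s = mk n (Rit.ofBase n s) :=
  (mk_map 0 n n.zero_le s).symm

theorem ofBase_le_ofBase {s t : S} : ofBase s ≤ ofBase t ↔ s ≤ t := mk_le_mk

theorem ofBase_sup (s t : S) : ofBase (s ⊔ t) = ofBase s ⊔ ofBase t := (mk_sup_mk 0 s t).symm

theorem ofBase_bot : ofBase (⊥ : S) = ⊥ := rfl

theorem ofBase_finset_sup {ι : Type*} (s : Finset ι) (f : ι → S) :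
    ofBase (s.sup f) = s.sup fun i => ofBase (f i) := by
  classical
  induction s using Finset.induction_on with
  | empty => exact ofBase_bot
  | insert i s _ ih => rw [Finset.sup_insert, Finset.sup_insert, ← ih, ofBase_sup]

theorem bot_eq_mk (n : ℕ) : (⊥ : D S) = mk n ⊥ := by
  change mk 0 ⊥ = _
  rw [← mk_map 0 n n.zero_le, map_bot]

/-- The subsemilattice of `D S` generated by `P`. -/
def sub (P : Set S) : Set (D S) := {x | ∃ n, ∃ a ∈ Ritsub P n, x = mk n a}

theorem exists_of_mem_sub {P : Set S} {x : D S} (hx : x ∈ sub P) :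
    ∃ n, ∀ m ≥ n, ∃ a ∈ Ritsub P m, x = mk m a := by
  obtain ⟨n, a, ha, rfl⟩ := hx
  exact ⟨n, fun m h => ⟨_, Ritsub.map_mem h ha, (mk_map n m h a).symm⟩⟩

theorem sub_isSub {P : Set S} (hP : IsSub P) : IsSub (sub P) where
  bot_mem := ⟨0, ⊥, hP.bot_mem, rfl⟩
  sup_mem := by
    intro x y hx hy
    obtain ⟨n, hn⟩ := exists_of_mem_sub hx
    obtain ⟨m, hm⟩ := exists_of_mem_sub hy
    obtain ⟨a, ha, rfl⟩ := hn (max n m) (le_max_left n m)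
    obtain ⟨b, hb, rfl⟩ := hm (max n m) (le_max_right n m)
    exact ⟨_, _, (Ritsub.isSub hP _).sup_mem ha hb, mk_sup_mk _ a b⟩

theorem sub_mono {P Q : Set S} (h : P ⊆ Q) : sub P ⊆ sub Q := by
  rintro x ⟨n, a, ha, rfl⟩
  exact ⟨n, a, Ritsub.mono h n ha, rfl⟩

theorem exists_mem_sub {ι : Type v} [SemilatticeSup ι] [Nonempty ι] {P : ι → Set S}
    (hmono : Monotone P) (hcov : ∀ s, ∃ i, s ∈ P i) (x : D S) : ∃ i, x ∈ sub (P i) := by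
  obtain ⟨n, a, rfl⟩ := exists_eq_mk x
  obtain ⟨i, hi⟩ := Ritsub.exists_mem hmono hcov n a
  exact ⟨i, n, a, hi, rfl⟩

theorem evaporates {P P₀ P₁ : Set S} {d₀ d₁ w₀ w₁ : S}
    (H : Evaporates P P₀ P₁ d₀ d₁ w₀ w₁)
    (hP : IsSub P) (hP₀ : IsSub P₀) (hP₁ : IsSub P₁) (hd₀ : Cancels P d₀) (hd₁ : Cancels P d₁)
    (hw₁ : Cancels P₀ w₁) (hw₀ : Cancels P₁ w₀) :
    Evaporates (sub P) (sub P₀) (sub P₁) (ofBase d₀) (ofBase d₁) (ofBase w₀)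
      (ofBase w₁) := by
  intro x hx y hy z hz
  obtain ⟨i, hi⟩ := exists_of_mem_sub hx
  obtain ⟨j, hj⟩ := exists_of_mem_sub hy
  obtain ⟨k, hk⟩ := exists_of_mem_sub hz
  set n := max (max i j) k
  obtain ⟨a, ha, rfl⟩ := hi n ((le_max_left i j).trans (le_max_left _ _))
  obtain ⟨b, hb, rfl⟩ := hj n ((le_max_right i j).trans (le_max_left _ _))
  obtain ⟨c, hc, rfl⟩ := hk n (le_max_right _ _)
  rw [ofBase_eq_mk n d₀, ofBase_eq_mk n d₁, ofBase_eq_mk n w₀, ofBase_eq_mk n w₁, mk_sup_mk,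
    bot_eq_mk n]
  simp only [mk_le_mk, (mk_injective n).eq_iff]
  exact H.iterate hP hP₀ hP₁ hd₀ hd₁ hw₁ hw₀ n a ha b hb c hc

end D

end Iterates

/-! ### Supports in `𝓛(Ω)` and `𝓖(Ω)` -/

namespace LSem

variable {Ω : Type u}

/-- The generators of `𝓛(Ω)` with index in `Y`. -/
def gensOver (Y : Set Ω) : Set (LGen Ω)
  | LGen.one => True
  | LGen.a _ ξ => ξ ∈ Y

/-- The subsemilattice `𝓛(Y)` of `𝓛(Ω)`. -/
def supp (Y : Set Ω) : Set (LSem Ω) := {x | ∃ A ⊆ gensOver Y, x.1 = cl (LRel Ω) A}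

/-- The generator `a_i^ξ` of `𝓛(Ω)`. -/
def a (i : Fin 2) (ξ : Ω) : LSem Ω := Presented.gen (LRel Ω) (LGen.a i ξ)

theorem supp_isSub (Y : Set Ω) : IsSub (supp Y) where
  bot_mem := ⟨∅, Set.empty_subset _, rfl⟩
  sup_mem := by
    rintro a b ⟨A, hA, ha⟩ ⟨B, hB, hb⟩
    refine ⟨A ∪ B, Set.union_subset hA hB, ?_⟩
    change cl _ (a.1 ∪ b.1) = _
    rw [ha, hb]
    refine Set.Subset.antisymm (cl_subset (Set.union_subset ?_ ?_)) (cl_mono ?_)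
    · exact cl_mono Set.subset_union_left
    · exact cl_mono Set.subset_union_right
    · exact Set.union_subset_union (subset_cl _ A) (subset_cl _ B)

theorem supp_mono {Y Z : Set Ω} (h : Y ⊆ Z) : supp Y ⊆ supp Z := by
  rintro x ⟨A, hA, hx⟩
  refine ⟨A, fun g hg => ?_, hx⟩
  have := hA hg
  cases g with
  | one => trivial
  | a i ξ => exact h this

theorem exists_mem_supp (x : LSem Ω) : ∃ F : Finset Ω, x ∈ supp (F : Set Ω) := by
  classical
  obtain ⟨A, hA, hx⟩ := x.2
  have hinj : Function.Injective fun p : Fin 2 × Ω => LGen.a p.1 p.2 := by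
    rintro ⟨i, ξ⟩ ⟨j, η⟩ h
    cases h
    rfl
  refine ⟨((hA.preimage hinj.injOn).toFinset).image Prod.snd, A, fun g hg => ?_, hx⟩
  cases g with
  | one => trivial
  | a i ξ =>
    refine Finset.mem_coe.2 (Finset.mem_image.2 ⟨(i, ξ), ?_, rfl⟩)
    simpa using hg

/-- A closed set without `1` lies in the set of generating `a_i^ξ`. -/
theorem index_mem_of_mem {Y : Set Ω} {x : LSem Ω} (hx : x ∈ supp Y) (h1 : LGen.one ∉ x.1)
    {i : Fin 2} {ξ : Ω} (h : LGen.a i ξ ∈ x.1) : ξ ∈ Y := by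
  obtain ⟨A, hA, hx⟩ := hx
  have hsub : A ⊆ x.1 := hx ▸ subset_cl _ A
  have : cl (LRel Ω) A ⊆ A := by
    refine cl_subset_of_closed le_rfl ?_
    rintro P x (⟨i, ξ⟩ | ξ) hP
    · exact (h1 (hsub (hP rfl))).elim
    · refine (h1 ?_).elim
      exact x.rule_mem (LRel.one_le ξ) (hP.trans hsub)
  exact hA (this (hx ▸ h))

/-- Generators with a single lower index i trigger no rule: producing 1 needs both a_0^ξ and a_1^ξ.
-/
theorem sup_a_subset (i : Fin 2) (V : Finset Ω) :
    (V.sup (a i)).1 ⊆ {g | ∃ ξ ∈ V, g = LGen.a i ξ} := by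
  have hclosed : ∀ P x, LRel Ω P x → P ⊆ {g | ∃ ξ ∈ V, g = LGen.a i ξ} →
      x ∈ {g | ∃ ξ ∈ V, g = LGen.a i ξ} := by
    rintro P x (⟨j, ξ⟩ | ξ) hP
    · obtain ⟨η, -, h⟩ := hP rfl
      cases h
    · obtain ⟨η, -, h⟩ := hP (Set.mem_insert _ _)
      obtain ⟨η', -, h'⟩ := hP (Set.mem_insert_of_mem _ rfl)
      cases h
      cases h'
  refine Finset.sup_induction (p := fun x : LSem Ω => x.1 ⊆ {g | ∃ ξ ∈ V, g = LGen.a i ξ}) ?_ ?_ ?_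
  · exact cl_subset_of_closed (Set.empty_subset _) hclosed
  · exact fun x hx y hy => Presented.sup_subset_of_closed hx hy hclosed
  · exact fun ξ hξ => Presented.gen_subset_of_closed ⟨ξ, hξ, rfl⟩ hclosed

/-- If s contains 1 there is nothing to cancel. Otherwise adjoining the a_i^ξ, ξ ∈ V, to s triggers
no rule: the pair a_0^ξ, a_1^ξ cannot come from V alone, and a mixed pair would put ξ in both V and
Y. -/
theorem cancels {Y : Set Ω} (i : Fin 2) (V : Finset Ω) (h : ∀ ξ ∈ V, ξ ∉ Y) :
    Cancels (supp Y) (V.sup (a i)) := by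
  rintro p ⟨A, hA, hp⟩ s hs hle
  by_cases h1 : LGen.one ∈ s.1
  · refine Presented.le_of_cl_subset hp fun g hg => ?_
    cases g with
    | one => exact h1
    | a j ξ => exact s.rule_mem (LRel.le_one j ξ) (Set.singleton_subset_iff.2 h1)
  · have key : (s ⊔ V.sup (a i)).1 ⊆ s.1 ∪ {g | ∃ ξ ∈ V, g = LGen.a i ξ} := by
      refine Presented.sup_subset_of_closed Set.subset_union_left
        ((sup_a_subset i V).trans Set.subset_union_right) ?_
      rintro P x (⟨j, ξ⟩ | ξ) hP
      · rcases hP rfl with h2 | ⟨η, -, h2⟩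
        · exact (h1 h2).elim
        · cases h2
      · rcases hP (Set.mem_insert _ _) with h2 | ⟨η, hη, h2⟩ <;>
          rcases hP (Set.mem_insert_of_mem _ rfl) with h3 | ⟨η', hη', h3⟩
        · refine (h1 (s.rule_mem (LRel.one_le ξ) ?_)).elim
          rintro _ (rfl | rfl) <;> assumption
        · cases h3
          exact (h ξ hη' (index_mem_of_mem hs h1 h2)).elim
        · cases h2
          exact (h ξ hη (index_mem_of_mem hs h1 h3)).elim
        · cases h2
          cases h3
    refine Presented.le_of_cl_subset hp fun g hg => ?_
    rcases key (hle (hp ▸ subset_cl _ A hg)) with h2 | ⟨ξ, hξ, rfl⟩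
    · exact h2
    · exact (h ξ hξ (hA hg)).elim

theorem eq_bot_of_le {i j : Fin 2} {U V : Finset Ω} (h : Disjoint U V) {x : LSem Ω}
    (hU : x ≤ U.sup (a i)) (hV : x ≤ V.sup (a j)) : x = ⊥ := by
  refine le_bot_iff.1 fun g hg => ?_
  obtain ⟨ξ, hξ, rfl⟩ := sup_a_subset i U (hU hg)
  obtain ⟨η, hη, h2⟩ := sup_a_subset j V (hV hg)
  cases h2
  exact (Finset.disjoint_left.1 h hξ hη).elim

/-- In 𝓛(Ω) the bounds alone already make x and y zero, so supports are irrelevant; they matter only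
when passing to R. -/
theorem evaporates {i₀ i₁ j₀ j₁ : Fin 2} {ξ : Ω} {V₀ V₁ : Finset Ω} (P P₀ P₁ : Set (LSem Ω))
    (h₀ : ξ ∉ V₀) (h₁ : ξ ∉ V₁) :
    Evaporates P P₀ P₁ (a i₀ ξ) (a i₁ ξ) (V₀.sup (a j₀)) (V₁.sup (a j₁)) := by
  intro x _ y _ z _ hx1 hx2 hy1 hy2 hz
  rw [eq_bot_of_le (U := {ξ}) (by simpa using h₀) (by simpa using hx1) hx2,
    eq_bot_of_le (U := {ξ}) (by simpa using h₁) (by simpa using hy1) hy2] at hz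
  simpa using hz

end LSem

namespace G

variable {Ω : Type u}

/-- The element `a_i^ξ` of `𝓖(Ω)`. -/
def a (ξ : Ω) (i : Fin 2) : G Ω := D.ofBase (LSem.a i ξ)

/-- The subsemilattice `𝓖(Y)` of `𝓖(Ω)`. -/
def supp (Y : Set Ω) : Set (G Ω) := D.sub (LSem.supp Y)

theorem supp_isSub (Y : Set Ω) : IsSub (supp Y) := D.sub_isSub (LSem.supp_isSub Y)

theorem supp_mono {Y Z : Set Ω} (h : Y ⊆ Z) : supp Y ⊆ supp Z := D.sub_mono (LSem.supp_mono h)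

theorem exists_mem_supp (x : G Ω) : ∃ F : Finset Ω, x ∈ supp (F : Set Ω) := by
  classical
  exact D.exists_mem_sub (P := fun F : Finset Ω => LSem.supp (F : Set Ω))
    (fun _ _ h => LSem.supp_mono (Finset.coe_subset.2 h)) LSem.exists_mem_supp x

theorem mk_sup_a (i : Fin 2) (V : Finset Ω) :
    D.ofBase (V.sup (LSem.a i)) = V.sup fun ξ => a ξ i :=
  D.ofBase_finset_sup V (LSem.a i)

theorem one_le (ξ : Ω) : one Ω ≤ a ξ 0 ⊔ a ξ 1 := by
  change D.ofBase (Presented.gen (LRel Ω) LGen.one) ≤ D.ofBase _ ⊔ D.ofBase _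
  rw [← D.ofBase_sup, D.ofBase_le_ofBase, Presented.gen_le_iff]
  refine Presented.rule_mem _ (LRel.one_le ξ) ?_
  rintro _ (rfl | rfl)
  · exact (le_sup_left : LSem.a 0 ξ ≤ LSem.a 0 ξ ⊔ LSem.a 1 ξ) (Presented.mem_gen _)
  · exact (le_sup_right : LSem.a 1 ξ ≤ LSem.a 0 ξ ⊔ LSem.a 1 ξ) (Presented.mem_gen _)

theorem not_one_le (i : Fin 2) (V : Finset Ω) : ¬ one Ω ≤ V.sup fun ξ => a ξ i := by
  rw [← mk_sup_a]
  change ¬ D.ofBase (Presented.gen (LRel Ω) LGen.one) ≤ _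
  rw [D.ofBase_le_ofBase]
  intro h
  obtain ⟨ξ, -, h2⟩ := LSem.sup_a_subset i V (h (Presented.mem_gen LGen.one))
  cases h2

/-- The supports supply the cancellations needed for the transfer from 𝓛(Ω): joins over V₁ cancel
for x, joins over V₀ for y, and the generators at ξ for z. -/
theorem evaporation {i₀ i₁ j₀ j₁ : Fin 2} {ξ : Ω} {V₀ V₁ : Finset Ω} {x y z : G Ω}
    (h₀ : ξ ∉ V₀) (h₁ : ξ ∉ V₁) (hx : x ∈ supp (V₁ : Set Ω)ᶜ) (hy : y ∈ supp (V₀ : Set Ω)ᶜ)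
    (hz : z ∈ supp {ξ}ᶜ) (hx₁ : x ≤ a ξ i₀) (hx₂ : x ≤ V₀.sup fun η => a η j₀)
    (hy₁ : y ≤ a ξ i₁) (hy₂ : y ≤ V₁.sup fun η => a η j₁) (h : z ≤ x ⊔ y) : z = ⊥ := by
  have hc : ∀ i, Cancels (LSem.supp {ξ}ᶜ) (LSem.a i ξ) := fun i => by
    simpa using LSem.cancels (Y := {ξ}ᶜ) i {ξ} (by simp)
  refine D.evaporates (LSem.evaporates _ _ _ h₀ h₁) (LSem.supp_isSub _) (LSem.supp_isSub _)
    (LSem.supp_isSub _) (hc i₀) (hc i₁) (LSem.cancels j₁ V₁ (by simp)) (LSem.cancels j₀ V₀ (by simp))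
    x hx y hy z hz hx₁ ?_ hy₁ ?_ h
  · exact (mk_sup_a j₀ V₀).symm ▸ hx₂
  · exact (mk_sup_a j₁ V₁).symm ▸ hy₂

end G

/-! ### Free sets -/

/-- One direction of Kuratowski's free set theorem. -/
theorem exists_free_set {X : Type v} (n : ℕ) : ∀ (Y : Set X), ℵ_ (n : Ordinal) ≤ #Y →
    ∀ Φ : Finset X → Finset X, ∃ U : Finset X, (U : Set X) ⊆ Y ∧ U.card = n + 1 ∧
      ∀ ξ ∈ U, ∀ F ⊆ U, ξ ∉ F → ξ ∉ Φ F := by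
  classical
  induction n with
  | zero =>
    intro Y hY Φ
    have hinf : Y.Infinite := by
      rw [Nat.cast_zero, aleph_zero] at hY
      exact Set.infinite_coe_iff.1 (Cardinal.infinite_iff.2 hY)
    obtain ⟨ξ, hξ, hξΦ⟩ := hinf.exists_notMem_finset (Φ ∅)
    refine ⟨{ξ}, by simpa using hξ, by simp, fun η hη F hF hηF => ?_⟩
    rw [Finset.mem_singleton] at hη
    subst hη
    rcases Finset.subset_singleton_iff.1 hF with rfl | rfl
    · exact hξΦ
    · simp at hηF
  | succ n ih =>
    intro Y hY Φ
    have hlt : ℵ_ (n : Ordinal.{v}) < ℵ_ ((n + 1 : ℕ) : Ordinal.{v}) :=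
      aleph_lt_aleph.2 (by exact_mod_cast n.lt_succ_self)
    obtain ⟨Z, hZY, hZ⟩ := Cardinal.le_mk_iff_exists_subset.1 (hlt.le.trans hY)
    have hZinf : Infinite Z := Cardinal.infinite_iff.2 (hZ ▸ aleph0_le_aleph _)
    -- `W` collects everything reached from finite subsets of Z; it has size at most ℵ_n, so some δ
    -- in Y escapes it.
    let W : Set X := ⋃ F : Finset Z, ((F.map (Function.Embedding.subtype _) ∪
      Φ (F.map (Function.Embedding.subtype _)) : Finset X) : Set X)
    have hW : #W < #Y := by
      refine lt_of_le_of_lt ?_ (hlt.trans_le hY)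
      refine (Cardinal.mk_iUnion_le _).trans ?_
      rw [Cardinal.mk_finset_of_infinite, hZ]
      refine (mul_le_mul_right (ciSup_le' fun F => ?_) _).trans
        (Cardinal.mul_eq_self (aleph0_le_aleph _)).le
      exact (Cardinal.lt_aleph0_of_finite _).le.trans (aleph0_le_aleph _)
    obtain ⟨δ, hδY, hδW⟩ : ∃ δ ∈ Y, δ ∉ W := by
      by_contra! h
      exact (Cardinal.mk_le_mk_of_subset h).not_gt hW
    have hδ : ∀ F : Finset X, (F : Set X) ⊆ Z → δ ∉ F ∧ δ ∉ Φ F := by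
      intro F hF
      have := fun h => hδW (Set.mem_iUnion.2 ⟨F.subtype (· ∈ Z), h⟩)
      rw [Finset.subtype_map_of_mem (fun x hx => hF hx)] at this
      simpa [not_or] using this
    -- The modified map makes the free set of Z free also with respect to sets containing δ.
    obtain ⟨U, hUZ, hU, hfree⟩ := ih Z hZ.ge fun F => Φ F ∪ Φ (insert δ F)
    have hδU := (hδ U hUZ).1
    refine ⟨insert δ U, ?_, by rw [Finset.card_insert_of_notMem hδU, hU], ?_⟩
    · rw [Finset.coe_insert]
      exact Set.insert_subset hδY (hUZ.trans hZY)
    · intro ξ hξ F hF hξF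
      by_cases hδF : δ ∈ F
      · have hξU : ξ ∈ U := (Finset.mem_insert.1 hξ).resolve_left fun h => hξF (h ▸ hδF)
        have := hfree ξ hξU (F.erase δ) (Finset.subset_insert_iff.1 hF)
          (fun h => hξF (Finset.mem_of_mem_erase h))
        rw [Finset.insert_erase hδF] at this
        exact fun h => this (Finset.mem_union_right _ h)
      · have hFU : F ⊆ U := (Finset.subset_insert_iff_of_notMem hδF).1 hF
        rcases Finset.mem_insert.1 hξ with rfl | hξU
        · exact (hδ F ((Finset.coe_subset.2 hFU).trans hUZ)).2
        · exact fun h => hfree ξ hξU F hFU hξF (Finset.mem_union_left _ h)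

/-! ### The semilattices `Sem(m, Ω)` -/

namespace Sem

variable {m : ℕ} {Ω : Type v}

/-- The element `k · ξ` of `Sem(m, Ω)`, for a natural number `k ≤ m + 1`. -/
def point (k : ℕ) (ξ : Ω) : Sem m Ω := pt (Fin.ofNat (m + 2) k) ξ

theorem pt_succ (k : Fin (m + 1)) (ξ : Ω) : pt k.succ ξ = point (m := m) (k + 1) ξ := by
  unfold point
  congr 1
  ext
  exact (Nat.mod_eq_of_lt (Nat.succ_lt_succ k.2)).symm

theorem pt_castSucc (k : Fin (m + 1)) (ξ : Ω) : pt k.castSucc ξ = point (m := m) k ξ := by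
  unfold point
  congr 1
  ext
  exact (Nat.mod_eq_of_lt (k.2.trans (Nat.lt_succ_self _))).symm

theorem gen_le_gen {x y : SemGen m Ω} (h : SemRel m Ω {x} y) :
    Presented.gen (SemRel m Ω) y ≤ Presented.gen (SemRel m Ω) x :=
  Presented.gen_le_iff.2 (Presented.rule_mem _ h (Set.singleton_subset_iff.2 (Presented.mem_gen x)))

theorem zero_eq_bot : zero m Ω = ⊥ :=
  le_bot_iff.1 (Presented.gen_le_iff.2 (Presented.rule_mem _ SemRel.bot (Set.empty_subset _)))

theorem point_zero (ξ : Ω) : (point 0 ξ : Sem m Ω) = ⊥ := by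
  rw [← zero_eq_bot]
  exact le_antisymm (gen_le_gen (SemRel.pt_zero_le ξ)) (gen_le_gen (SemRel.zero_le_pt ξ))

theorem point_last (ξ : Ω) : (point (m + 1) ξ : Sem m Ω) = one m Ω := by
  have h := pt_succ (Fin.last m) ξ
  rw [Fin.val_last] at h
  rw [← h]
  exact le_antisymm (gen_le_gen (SemRel.pt_last_le ξ)) (gen_le_gen (SemRel.one_le_pt ξ))

theorem point_le_point_succ {k : ℕ} (hk : k ≤ m) (ξ : Ω) :
    (point k ξ : Sem m Ω) ≤ point (k + 1) ξ := by
  have h := gen_le_gen (SemRel.step (⟨k, Nat.lt_succ_of_le hk⟩ : Fin (m + 1)) ξ)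
  exact (pt_castSucc ⟨k, Nat.lt_succ_of_le hk⟩ ξ).symm.trans_le
    (h.trans_eq (pt_succ ⟨k, Nat.lt_succ_of_le hk⟩ ξ))

theorem point_le_one {k : ℕ} (hk : k ≤ m + 1) (ξ : Ω) : (point k ξ : Sem m Ω) ≤ one m Ω := by
  induction hk using Nat.decreasingInduction with
  | self => exact (point_last ξ).le
  | of_succ k hk ih => exact (point_le_point_succ (Nat.le_of_lt_succ hk) ξ).trans ih

/-- The join-subsemilattice of `Sem(m, Ω)` generated by the zero and the `k · ξ` with `ξ ∈ F`. -/
def supp (m : ℕ) (F : Finset Ω) : Set (Sem m Ω) :=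
  (fun A : Finset (Ω × Fin (m + 2)) => A.sup fun q => pt q.2 q.1) ''
    ((F ×ˢ (Finset.univ : Finset (Fin (m + 2)))).powerset : Set (Finset (Ω × Fin (m + 2))))

theorem supp_finite (F : Finset Ω) : (supp m F).Finite := (Finset.finite_toSet _).image _

theorem supp_isSub (F : Finset Ω) : IsSub (supp m F) where
  bot_mem := ⟨∅, by simp, by simp⟩
  sup_mem := by
    classical
    rintro _ _ ⟨A, hA, rfl⟩ ⟨B, hB, rfl⟩
    refine ⟨A ∪ B, ?_, Finset.sup_union⟩
    simp only [Finset.mem_coe, Finset.mem_powerset] at hA hB ⊢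
    exact Finset.union_subset hA hB

theorem point_mem_supp {F : Finset Ω} {ξ : Ω} (h : ξ ∈ F) (k : ℕ) : point k ξ ∈ supp m F :=
  ⟨{(ξ, Fin.ofNat (m + 2) k)}, by simpa using h, by simp [point]⟩

theorem one_mem_supp {F : Finset Ω} {ξ : Ω} (h : ξ ∈ F) : one m Ω ∈ supp m F :=
  point_last (m := m) ξ ▸ point_mem_supp h _

end Sem

/-! ### Refinement maps -/

namespace IsRefinementMap

variable {S : Type u} [SemilatticeSup S] [OrderBot S] {m : ℕ} {Ω : Type v} {e : S}
  {a : Ω → Fin 2 → S} {c : Sem m Ω → Sem m Ω → S}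

theorem mono_left (hc : IsRefinementMap e a c) {p q : Sem m Ω} (h : p ≤ q) (r : Sem m Ω) :
    c p r ≤ c q r := by
  rw [← sup_eq_right.2 h, hc.sup_left]
  exact le_sup_left

theorem anti_right (hc : IsRefinementMap e a c) (p : Sem m Ω) {q r : Sem m Ω} (h : q ≤ r) :
    c p r ≤ c p q := by
  simpa [hc.eq_zero q r h] using hc.triangle p q r

theorem sup_sup_le (hc : IsRefinementMap e a c) (p q r : Sem m Ω) : c (p ⊔ r) (q ⊔ r) ≤ c p q := by
  rw [hc.sup_left, hc.eq_zero r (q ⊔ r) le_sup_right, sup_bot_eq]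
  exact hc.anti_right p le_sup_left

theorem finset_sup_le (hc : IsRefinementMap e a c) {ι : Type*} (s : Finset ι)
    (f g : ι → Sem m Ω) : c (s.sup f) (s.sup g) ≤ s.sup fun i => c (f i) (g i) := by
  classical
  suffices h : ∀ r, c (s.sup f) r = s.sup fun i => c (f i) r by
    rw [h]
    exact Finset.sup_mono_fun fun i hi => hc.anti_right _ (Finset.le_sup hi)
  intro r
  induction s using Finset.induction_on with
  | empty => simpa using hc.eq_zero ⊥ r bot_le
  | insert i s _ ih => rw [Finset.sup_insert, Finset.sup_insert, hc.sup_left, ih]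

theorem step_point_le (hc : IsRefinementMap e a c) (ξ : Ω) {k : ℕ} (hk : k ≤ m) :
    c (Sem.point (k + 1) ξ) (Sem.point k ξ) ≤ a ξ (parity k) := by
  have h := hc.step_le ξ ⟨k, Nat.lt_succ_of_le hk⟩
  rwa [Sem.pt_succ, Sem.pt_castSucc] at h

/-- The erosion of the inequality `c(1, x₀ ∨ x₁) ≤ a₀ ∨ a₁` along the chain of the `k · ξ`. -/
theorem erosion (hc : IsRefinementMap e a c) (x : Fin 2 → Sem m Ω) (ξ : Ω) {T : Fin 2 → Set S}
    (hT : ∀ j, IsSub (T j))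
    (hcT : ∀ j k l, c (Sem.point k ξ ⊔ x j) (Sem.point l ξ ⊔ x j) ∈ T j) :
    ∃ y : Fin 2 → S, (∀ j, y j ∈ T j ∧ y j ≤ a ξ j ∧ y j ≤ c (Sem.one m Ω) (x j)) ∧
      c (Sem.one m Ω) (x 0 ⊔ x 1) ≤ y 0 ⊔ y 1 := by
  set z : ℕ → Sem m Ω := fun k => Sem.point k ξ with hz
  -- The k-th step along the chain is joined with the x of the parity of k, so that its value
  -- involves only that x; y_j gathers the steps of parity j.
  set w : ℕ → S := fun k => c (z (k + 1) ⊔ x (parity k)) (z k ⊔ x (parity k)) with hw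
  set y : Fin 2 → S := fun j => ((Finset.range (m + 1)).filter (parity · = j)).sup w with hy
  refine ⟨y, fun j => ⟨(hT j).finset_sup_mem _ _ fun k hk => ?_, Finset.sup_le fun k hk => ?_,
    Finset.sup_le fun k hk => ?_⟩, ?_⟩
  · rw [Finset.mem_filter] at hk
    obtain ⟨-, rfl⟩ := hk
    exact hcT _ _ _
  · rw [Finset.mem_filter, Finset.mem_range] at hk
    obtain ⟨hk, rfl⟩ := hk
    exact (hc.sup_sup_le _ _ _).trans (hc.step_point_le ξ (Nat.le_of_lt_succ hk))
  · rw [Finset.mem_filter, Finset.mem_range] at hk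
    obtain ⟨hk, rfl⟩ := hk
    refine (hc.anti_right _ le_sup_right).trans ?_
    rw [hc.sup_left, hc.eq_zero _ _ le_rfl, sup_bot_eq]
    exact hc.mono_left (Sem.point_le_one hk ξ) _
  · have hxw : ∀ k, c (z (k + 1) ⊔ (x 0 ⊔ x 1)) (z k ⊔ (x 0 ⊔ x 1)) ≤ w k := fun k => by
      have hx : x 0 ⊔ x 1 = x (parity k) ⊔ (x 0 ⊔ x 1) := by
        refine (sup_eq_right.2 ?_).symm
        unfold parity
        split_ifs
        exacts [le_sup_left, le_sup_right]
      rw [hx, ← sup_assoc (z (k + 1)), ← sup_assoc (z k)]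
      exact hc.sup_sup_le _ _ _
    have hchain : ∀ n, c (z n ⊔ (x 0 ⊔ x 1)) (z 0 ⊔ (x 0 ⊔ x 1)) ≤ (Finset.range n).sup w := by
      intro n
      induction n with
      | zero => exact (hc.eq_zero _ _ le_rfl).le.trans bot_le
      | succ n ih =>
        rw [Finset.range_add_one, Finset.sup_insert]
        exact (hc.triangle _ _ _).trans (sup_le_sup (hxw n) ih)
    have h := hchain (m + 1)
    simp only [hz, Sem.point_last, Sem.point_zero, bot_sup_eq] at h
    refine (hc.mono_left le_sup_left _).trans (h.trans (Finset.sup_le fun k hk => ?_))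
    have hle : ∀ j, parity k = j → w k ≤ y j := fun j hj =>
      Finset.le_sup (f := w) (Finset.mem_filter.2 ⟨hk, hj⟩)
    have h01 : parity k = 0 ∨ parity k = 1 := by
      unfold parity
      split_ifs <;> simp
    rcases h01 with h | h
    · exact (hle 0 h).trans le_sup_left
    · exact (hle 1 h).trans le_sup_right

end IsRefinementMap

/-! ### The failure of the refinement properties in `𝓖(Ω)` -/

section Failure

variable {Ω : Type u} {Ω' : Type v} {m : ℕ}

/-- The values of `c` on the elements over `F` are supported outside of any set avoiding `Φ F`. -/
theorem exists_support (f : Ω' ↪ Ω) (c : Sem m Ω' → Sem m Ω' → G Ω) :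
    ∃ Φ : Finset Ω' → Finset Ω', ∀ F V : Finset Ω', (∀ ξ ∈ V, ξ ∉ Φ F) →
      ∀ p ∈ Sem.supp m F, ∀ q ∈ Sem.supp m F, c p q ∈ G.supp ((V.map f : Finset Ω) : Set Ω)ᶜ := by
  classical
  choose Y hY using fun p q => G.exists_mem_supp (c p q)
  -- Only finitely many pairs lie over F; the supports of their values are united and pulled back
  -- along f.
  refine ⟨fun F => (((Sem.supp_finite (m := m) F).toFinset ×ˢ
    (Sem.supp_finite (m := m) F).toFinset).biUnion fun p => Y p.1 p.2).preimage f
      f.injective.injOn, fun F V hV p hp q hq => G.supp_mono ?_ (hY p q)⟩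
  intro η hη hηV
  obtain ⟨ξ, hξ, rfl⟩ := Finset.mem_map.1 (Finset.mem_coe.1 hηV)
  refine hV ξ hξ ?_
  rw [Finset.mem_preimage, Finset.mem_biUnion]
  exact ⟨(p, q), by simpa using ⟨hp, hq⟩, hη⟩

/-- Induction on k kills c(1, ⋁_{ξ∈V} (m+1-k)·ξ) for free sets V of size 2^k. The doubling at each
step accounts for the exponent 2^m. -/
theorem not_isRefinementMap (f : Ω' ↪ Ω) (hcard : ℵ_ ((2 ^ m : ℕ) : Ordinal) ≤ #Ω')
    (c : Sem m Ω' → Sem m Ω' → G Ω) : ¬ IsRefinementMap (G.one Ω) (fun ξ => G.a (f ξ)) c := by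
  classical
  intro hc
  obtain ⟨Φ, hΦ⟩ := exists_support f c
  obtain ⟨U, -, hU, hfree⟩ := exists_free_set (2 ^ m) Set.univ (by rwa [Cardinal.mk_univ]) Φ
  have hsupp : ∀ F ⊆ U, ∀ V ⊆ U, Disjoint F V → ∀ p ∈ Sem.supp m F, ∀ q ∈ Sem.supp m F,
      c p q ∈ G.supp ((V.map f : Finset Ω) : Set Ω)ᶜ := fun F hF V hV h =>
    hΦ F V fun ξ hξ => hfree ξ (hV hξ) F hF (Finset.disjoint_right.1 h hξ)
  have main : ∀ k ≤ m, ∀ V ⊆ U, V.card = 2 ^ k →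
      c (Sem.one m Ω') (V.sup (Sem.point (m + 1 - k))) = ⊥ := by
    intro k
    induction k with
    | zero =>
      intro _ V _ hV
      obtain ⟨ξ, rfl⟩ := Finset.card_eq_one.1 hV
      rw [Finset.sup_singleton, Nat.sub_zero, Sem.point_last]
      exact hc.eq_zero _ _ le_rfl
    | succ k ih =>
      intro hk V hVU hV
      obtain ⟨j, rfl⟩ : ∃ j, m = j + k := ⟨m - k, by omega⟩
      have e1 : j + k + 1 - k = j + 1 := by omega
      have e2 : j + k + 1 - (k + 1) = j := by omega
      rw [e1] at ih
      rw [e2]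
      obtain ⟨V₀, hV₀, hV₀c⟩ := Finset.exists_subset_card_eq (s := V) (n := 2 ^ k)
        (by rw [hV]; exact Nat.pow_le_pow_right (by norm_num) (Nat.le_succ k))
      set V₁ := V \ V₀ with hV₁
      have hV₁c : V₁.card = 2 ^ k := by
        rw [hV₁, Finset.card_sdiff_of_subset hV₀, hV, hV₀c, pow_succ]
        omega
      have hVV : V₀ ∪ V₁ = V := Finset.union_sdiff_of_subset hV₀
      have hV₁V : V₁ ⊆ V := Finset.sdiff_subset
      have hdisj : Disjoint V₀ V₁ := Finset.disjoint_sdiff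
      -- This is why U has 2^m + 1 elements: even when V has 2^m, one index is left over.
      obtain ⟨ξ, hξU, hξV⟩ : ∃ ξ ∈ U, ξ ∉ V := by
        refine Finset.exists_mem_notMem_of_card_lt_card ?_
        rw [hU, hV]
        exact Nat.lt_succ_of_le (Nat.pow_le_pow_right (by norm_num) hk)
      have hξ₀ : ξ ∉ V₀ := fun h => hξV (hV₀ h)
      have hξ₁ : ξ ∉ V₁ := fun h => hξV (hV₁V h)
      have hne : ∃ α, α ∈ V := Finset.card_pos.1 (by rw [hV]; positivity)
      obtain ⟨α, hα⟩ := hne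
      -- By the triangle inequality through level j + 1, where the induction hypothesis gives zero,
      -- only the step from j to j + 1 remains.
      have hxle : ∀ W ⊆ U, W.card = 2 ^ k → c (Sem.one (j + k) Ω') (W.sup (Sem.point j)) ≤
          (W.map f).sup fun η => G.a η (parity j) := by
        intro W hW hWc
        refine (hc.triangle _ (W.sup (Sem.point (j + 1))) _).trans ?_
        rw [ih (Nat.le_of_succ_le hk) W hW hWc, bot_sup_eq, Finset.sup_map]
        exact (hc.finset_sup_le _ _ _).trans
          (Finset.sup_mono_fun fun η _ => hc.step_point_le η (Nat.le_add_right j k))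
      have hmem : ∀ W ⊆ U, ∀ W' ⊆ U, ξ ∉ W' → Disjoint W W' → ∀ i l,
          c (Sem.point i ξ ⊔ W.sup (Sem.point j)) (Sem.point l ξ ⊔ W.sup (Sem.point j)) ∈
            G.supp ((W'.map f : Finset Ω) : Set Ω)ᶜ := by
        intro W hW W' hW' hξ hd i l
        have hp : ∀ i, Sem.point i ξ ⊔ W.sup (Sem.point j) ∈ Sem.supp (j + k) (insert ξ W) :=
          fun i => (Sem.supp_isSub _).sup_mem (Sem.point_mem_supp (Finset.mem_insert_self _ _) i)
            ((Sem.supp_isSub _).finset_sup_mem _ _ fun η hη =>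
              Sem.point_mem_supp (Finset.mem_insert_of_mem hη) j)
        exact hsupp _ (Finset.insert_subset hξU hW) _ hW' (Finset.disjoint_insert_left.2 ⟨hξ, hd⟩)
          _ (hp i) _ (hp l)
      -- Each piece involves ξ and one half only, so by freeness its support avoids the other half.
      obtain ⟨y, hy, hle⟩ := hc.erosion ![V₀.sup (Sem.point j), V₁.sup (Sem.point j)] ξ
        (T := ![G.supp ((V₁.map f : Finset Ω) : Set Ω)ᶜ, G.supp ((V₀.map f : Finset Ω) : Set Ω)ᶜ])
        (by
          intro i
          fin_cases i
          exacts [G.supp_isSub _, G.supp_isSub _])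
        (by
          intro i
          fin_cases i
          · exact hmem V₀ (hV₀.trans hVU) V₁ (hV₁V.trans hVU) hξ₁ hdisj
          · exact hmem V₁ (hV₁V.trans hVU) V₀ (hV₀.trans hVU) hξ₀ hdisj.symm)
      obtain ⟨hy₀, hya₀, hyc₀⟩ := hy 0
      obtain ⟨hy₁, hya₁, hyc₁⟩ := hy 1
      change c _ (V₀.sup (Sem.point j) ⊔ V₁.sup (Sem.point j)) ≤ _ at hle
      rw [← Finset.sup_union, hVV] at hle
      refine G.evaporation (V₀ := V₀.map f) (V₁ := V₁.map f) (ξ := f ξ) (by simpa using hξ₀)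
        (by simpa using hξ₁) hy₀ hy₁ ?_ hya₀ (hyc₀.trans (hxle V₀ (hV₀.trans hVU) hV₀c)) hya₁
        (hyc₁.trans (hxle V₁ (hV₁V.trans hVU) hV₁c)) hle
      have := hsupp V hVU {ξ} (by simpa using hξU) (by simpa using hξV) _ (Sem.one_mem_supp hα) _
        ((Sem.supp_isSub _).finset_sup_mem V (Sem.point j) fun η hη => Sem.point_mem_supp hη j)
      simpa using this
  obtain ⟨V, hVU, hV⟩ := Finset.exists_subset_card_eq (s := U) (n := 2 ^ m) (by omega)
  have h := main m le_rfl V hVU hV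
  rw [Nat.add_sub_cancel_left] at h
  -- The induction has reached level 1; the remaining step from 0 to 1 has parity 0, so it
  -- contributes only elements a_0^ξ.
  refine G.not_one_le 0 (V.map f) ?_
  rw [← hc.one_zero, Sem.zero_eq_bot]
  refine (hc.triangle _ (V.sup (Sem.point 1)) _).trans ?_
  have hbot : (⊥ : Sem m Ω') = V.sup (Sem.point 0) := by
    simp only [Finset.sup_congr rfl fun η (_ : η ∈ V) => Sem.point_zero (m := m) η, Finset.sup_bot]
  rw [h, bot_sup_eq, hbot, Finset.sup_map]
  exact (hc.finset_sup_le _ _ _).trans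
    (Finset.sup_mono_fun fun η _ => hc.step_point_le η (Nat.zero_le m))

/-- The index sets of `CLR` and `CLRm` live in universe v, while Ω lives in u; a copy of the right
cardinality is therefore embedded in Ω. -/
theorem exists_embedding {o : Ordinal.{0}} (h : #Ω = ℵ_ (Ordinal.lift.{u} o)) :
    ∃ Ω' : Type v, #Ω' = ℵ_ (Ordinal.lift.{v} o) ∧ Nonempty Ω' ∧ Nonempty (Ω' ↪ Ω) := by
  refine ⟨(ℵ_ (Ordinal.lift.{v} o)).out, mk_out _, ?_, ?_⟩
  · rw [← mk_ne_zero_iff, mk_out]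
    exact (aleph_pos _).ne'
  · rw [← lift_mk_le', mk_out, h, lift_aleph, lift_aleph, Ordinal.lift_lift, Ordinal.lift_lift]

theorem G.not_CLRm (m : ℕ+) (h : #Ω = ℵ_ ((2 ^ (m : ℕ) : ℕ) : Ordinal.{u})) :
    ¬ CLRm.{u, v} m (G.one Ω) := by
  intro H
  obtain ⟨Ω', hΩ', _, ⟨f⟩⟩ := exists_embedding.{u, v} (o := ((2 ^ (m : ℕ) : ℕ) : Ordinal.{0}))
    (by rwa [Ordinal.lift_natCast])
  rw [Ordinal.lift_natCast] at hΩ'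
  obtain ⟨c, hc⟩ := H Ω' (fun ξ => G.a (f ξ)) fun ξ => G.one_le (f ξ)
  exact not_isRefinementMap f hΩ'.ge c hc

/-- Each Ω_m has size at most ℵ_ω, since otherwise it would carry a forbidden refinement map.
Countably many such pieces cannot cover ℵ_{ω+1} indices. -/
theorem G.not_CLR (h : #Ω = ℵ_ (ω + 1)) : ¬ CLR.{u, v} (G.one Ω) := by
  intro H
  obtain ⟨Ω', hΩ', _, ⟨f⟩⟩ := exists_embedding.{u, v} (o := ω + 1)
    (by simpa using h)
  obtain ⟨Ωs, -, hcov, c, hc⟩ := H Ω' (fun ξ => G.a (f ξ)) fun ξ => G.one_le (f ξ)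
  have hsmall : ∀ m : ℕ+, #(Ωs m) ≤ ℵ_ ω := by
    intro m
    by_contra! hlt
    refine not_isRefinementMap ((Function.Embedding.subtype _).trans f) ?_ (c m) (hc m)
    exact (aleph_le_aleph.2 (natCast_lt_omega0 _).le).trans hlt.le
  have hle : #Ω' ≤ ℵ_ ω := by
    rw [← mk_univ, ← hcov]
    have := Cardinal.mk_iUnion_le_lift Ωs
    simp only [Cardinal.lift_uzero] at this
    refine this.trans ((mul_le_mul' (b := ℵ_ ω) (d := ℵ_ ω) ?_ (ciSup_le' hsmall)).trans
      (Cardinal.mul_eq_self (aleph0_le_aleph _)).le)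
    rw [Cardinal.lift_le_aleph0.2 (Cardinal.mk_le_aleph0) |>.antisymm (by simp)]
    exact aleph0_le_aleph _
  rw [hΩ', aleph_le_aleph] at hle
  simp at hle

end Failure

/-! ### Refinement maps into congruence semilattices of lattices -/

section Congruences

variable {L : Type u} [Lattice L]

theorem theta_rel (x y : L) : (theta x y).r x y := fun _ h => h

theorem Conc.principal_le_iff {x y : L} {d : Conc L} : Conc.principal x y ≤ d ↔ d.1.r x y :=
  ⟨fun h => h x y (theta_rel x y), fun h => sInf_le (α := LatticeCon L) h⟩

theorem LatticeCon.rel_inf_sup_iff (d : LatticeCon L) {x y : L} :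
    d.r (x ⊔ y) (x ⊓ y) ↔ d.r x y := by
  constructor
  · intro h
    have h1 := d.sup (d.refl x) h
    have h2 := d.sup (d.refl y) h
    rw [sup_eq_right.2 (le_sup_left : x ≤ x ⊔ y), sup_inf_self] at h1
    rw [sup_eq_right.2 (le_sup_right : y ≤ x ⊔ y), inf_comm, sup_inf_self] at h2
    exact d.trans (d.symm h1) h2
  · intro h
    have h1 := d.sup h (d.refl y)
    have h2 := d.inf h (d.refl y)
    rw [sup_idem] at h1
    rw [inf_idem] at h2
    exact d.trans h1 (d.symm h2)

theorem Conc.principal_sup_inf (x y : L) :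
    Conc.principal (x ⊔ y) (x ⊓ y) = Conc.principal x y :=
  eq_of_forall_ge_iff fun d => by
    rw [principal_le_iff, principal_le_iff, LatticeCon.rel_inf_sup_iff]

/-- The congruence generated by the union of two congruences. -/
def LatticeCon.gen (a b : LatticeCon L) : LatticeCon L where
  r := Relation.ReflTransGen fun x y => a.r x y ∨ b.r x y
  iseqv :=
    { refl := fun _ => Relation.ReflTransGen.refl
      symm := fun h =>
        haveI : Std.Symm fun x y => a.r x y ∨ b.r x y :=
          ⟨fun _ _ h => h.imp (fun h => a.symm h) (fun h => b.symm h)⟩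
        symm_of (Relation.ReflTransGen fun x y => a.r x y ∨ b.r x y) h
      trans := fun h1 h2 => h1.trans h2 }
  inf := fun {_ x y _} h1 h2 =>
    (h1.lift (· ⊓ y) fun _ _ h => h.imp (a.inf · (a.refl y)) (b.inf · (b.refl y))).trans
      (h2.lift (x ⊓ ·) fun _ _ h => h.imp (a.inf (a.refl x)) (b.inf (b.refl x)))
  sup := fun {_ x y _} h1 h2 =>
    (h1.lift (· ⊔ y) fun _ _ h => h.imp (a.sup · (a.refl y)) (b.sup · (b.refl y))).trans
      (h2.lift (x ⊔ ·) fun _ _ h => h.imp (a.sup (a.refl x)) (b.sup (b.refl x)))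

theorem LatticeCon.sup_le_gen (a b : LatticeCon L) : a ⊔ b ≤ LatticeCon.gen a b :=
  sup_le (fun _ _ h => Relation.ReflTransGen.single (Or.inl h))
    fun _ _ h => Relation.ReflTransGen.single (Or.inr h)

theorem altComp_succ_of_rel {a b : LatticeCon L} {n : ℕ} {x y z : L} (h : altComp a b n x y)
    (h' : (if Even (n + 1) then a else b).r y z) : altComp a b (n + 1) x z := by
  refine ⟨y, h, ?_⟩
  by_cases he : Even (n + 1)
  · rw [if_pos he] at h' ⊢
    exact h'
  · rw [if_neg he] at h' ⊢
    exact h'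

theorem altComp_succ {a b : LatticeCon L} {n : ℕ} {x y : L} (h : altComp a b n x y) :
    altComp a b (n + 1) x y :=
  altComp_succ_of_rel h (Setoid.refl' _ _)

theorem exists_altComp {a b : LatticeCon L} {x y : L} (h : (a ⊔ b).r x y) :
    ∃ m : ℕ+, altComp a b m x y := by
  suffices ∃ n, altComp a b n x y by
    obtain ⟨n, hn⟩ := this
    exact ⟨n.succPNat, altComp_succ hn⟩
  have h' : Relation.ReflTransGen (fun x y => a.r x y ∨ b.r x y) x y :=
    LatticeCon.sup_le_gen a b x y h
  clear h
  induction h' with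
  | refl => exact ⟨0, a.refl x⟩
  | @tail s t _ hst ih =>
    obtain ⟨n, hn⟩ := ih
    -- If the next factor has the wrong parity, a trivial step is inserted first.
    by_cases he : Even (n + 1)
    · rcases hst with hst | hst
      · exact ⟨n + 1, altComp_succ_of_rel hn (by rwa [if_pos he])⟩
      · refine ⟨n + 2, altComp_succ_of_rel (altComp_succ hn) ?_⟩
        rwa [if_neg (by rwa [Nat.even_add_one, not_not])]
    · rcases hst with hst | hst
      · refine ⟨n + 2, altComp_succ_of_rel (altComp_succ hn) ?_⟩
        rwa [if_pos (by rwa [Nat.even_add_one])]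
      · exact ⟨n + 1, altComp_succ_of_rel hn (by rwa [if_neg he])⟩

theorem altComp.exists_seq {a b : LatticeCon L} {m : ℕ} {x y : L} (h : altComp a b m x y) :
    ∃ t : ℕ → L, t 0 = x ∧ t (m + 1) = y ∧
      ∀ i ≤ m, (if Even i then a else b).r (t i) (t (i + 1)) := by
  induction m generalizing y with
  | zero =>
    refine ⟨fun i => if i = 0 then x else y, rfl, rfl, fun i hi => ?_⟩
    obtain rfl := Nat.le_zero.1 hi
    exact h
  | succ m ih =>
    obtain ⟨z, hz, hzy⟩ := h
    obtain ⟨t, h0, h1, ht⟩ := ih hz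
    refine ⟨Function.update t (m + 2) y, ?_, Function.update_self _ _ _, fun i hi => ?_⟩
    · rwa [Function.update_of_ne (by omega)]
    · rw [Function.update_of_ne (by omega)]
      rcases Nat.lt_or_eq_of_le hi with hi | rfl
      · rw [Function.update_of_ne (by omega)]
        exact ht i (Nat.le_of_lt_succ hi)
      · rw [h1, Function.update_self]
        by_cases he : Even (m + 1)
        · rw [if_pos he] at hzy ⊢
          exact hzy
        · rw [if_neg he] at hzy ⊢
          exact hzy

/-- Alternating sequences between the elements of an interval may be taken increasing. -/
theorem altComp.exists_chain {a b : LatticeCon L} {m : ℕ} {x y : L} (hxy : x ≤ y)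
    (h : altComp a b m x y) :
    ∃ t : ℕ → L, Monotone t ∧ t 0 = x ∧ t (m + 1) = y ∧
      ∀ i ≤ m, (if Even i then a else b).r (t (i + 1)) (t i) := by
  obtain ⟨t, h0, h1, ht⟩ := h.exists_seq
  -- Lattice polynomials preserve congruences, so truncation to [x, y], and then taking partial
  -- joins, keeps consecutive terms congruent.
  set w : ℕ → L := fun i => (t i ⊔ x) ⊓ y with hw
  have hr : ∀ i ≤ m, (if Even i then a else b).r (w (i + 1)) (w i) := fun i hi =>
    Setoid.symm' _ (LatticeCon.inf _ (LatticeCon.sup _ (ht i hi) (Setoid.refl' _ _))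
      (Setoid.refl' _ _))
  have hwle : ∀ i, partialSups w i ≤ y := fun i => partialSups_le w i _ fun _ _ => inf_le_right
  refine ⟨partialSups w, (partialSups w).monotone, ?_, le_antisymm (hwle _) ?_, fun i hi => ?_⟩
  · rw [partialSups_zero]
    simp only [hw, h0, sup_idem]
    exact inf_eq_left.2 hxy
  · refine le_trans ?_ (le_partialSups w (m + 1))
    simp only [hw, h1]
    exact le_inf le_sup_left le_rfl
  · have := LatticeCon.sup _ (Setoid.refl' _ (partialSups w i)) (hr i hi)
    rwa [← Order.succ_eq_add_one, ← partialSups_succ, sup_eq_left.2 (le_partialSups w i)] at this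

/-- The chains t ξ share their endpoints, so they extend to a join-homomorphism φ on Sem(m,Ω), and
c(x,y) = Θ(φx∨φy, φy) measures how far φx is from being below φy. -/
theorem exists_isRefinementMap {m : ℕ} {Ω : Type v} {p q : L} (hqp : q ≤ p)
    {a : Ω → Fin 2 → Conc L} (t : Ω → ℕ → L) (hmono : ∀ ξ, Monotone (t ξ))
    (h0 : ∀ ξ, t ξ 0 = q) (h1 : ∀ ξ, t ξ (m + 1) = p)
    (ht : ∀ ξ, ∀ i ≤ m, (a ξ (parity i)).1.r (t ξ (i + 1)) (t ξ i)) :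
    ∃ c : Sem m Ω → Sem m Ω → Conc L, IsRefinementMap (Conc.principal p q) a c := by
  have hq : ∀ ξ i, q ≤ t ξ i := fun ξ i => (h0 ξ).ge.trans (hmono ξ i.zero_le)
  -- The target is the up-set of q, so that it has a least element, the image of 0, even if L has
  -- none.
  obtain ⟨φ, hφ, hgen⟩ := Presented.exists_extension (r := SemRel m Ω) (T := Set.Ici q)
    (fun g => match g with
      | SemGen.zero => ⟨q, le_rfl⟩
      | SemGen.one => ⟨p, hqp⟩
      | SemGen.pt k ξ => ⟨t ξ k, hq ξ k⟩) (by
    rintro P x hr s hs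
    rw [← Subtype.coe_le_coe]
    cases hr with
    | bot => exact s.2
    | pt_zero_le ξ => exact (h0 ξ).le.trans s.2
    | zero_le_pt ξ => exact s.2
    | step k ξ => exact (hmono ξ (Nat.le_succ k)).trans (hs _ rfl)
    | pt_last_le ξ => exact (h1 ξ).le.trans (hs _ rfl)
    | one_le_pt ξ => exact (h1 ξ).ge.trans (hs _ rfl))
  refine ⟨fun x y => Conc.principal ((φ x : L) ⊔ φ y) (φ y), ?_, ?_, ?_, ?_, ?_⟩
  · intro x y hxy
    have : (φ x : L) ⊔ φ y = φ y := by
      rw [← sup_eq_right.2 hxy, hφ]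
      simp
    rw [this, ← le_bot_iff, Conc.principal_le_iff]
  · intro x y z
    rw [Conc.principal_le_iff]
    set d := Conc.principal ((φ x : L) ⊔ φ y) (φ y) ⊔ Conc.principal ((φ y : L) ⊔ φ z) (φ z)
    have hxy : d.1.r ((φ x : L) ⊔ φ y) (φ y) := Conc.principal_le_iff.1 le_sup_left
    have hyz : d.1.r ((φ y : L) ⊔ φ z) (φ z) := Conc.principal_le_iff.1 le_sup_right
    -- The path is φx∨φz, φx∨φy∨φz, φy∨φz, φz.
    have k1 := d.1.sup (d.1.refl (φ x : L)) (d.1.symm hyz)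
    have k2 := d.1.sup hxy (d.1.refl (φ z : L))
    rw [sup_assoc] at k2
    exact d.1.trans k1 (d.1.trans k2 hyz)
  · intro x y z
    have hxyz : (φ (x ⊔ y) : L) = φ x ⊔ φ y := by
      rw [hφ]
    rw [hxyz]
    apply le_antisymm
    · rw [Conc.principal_le_iff]
      set d := Conc.principal ((φ x : L) ⊔ φ z) (φ z) ⊔ Conc.principal ((φ y : L) ⊔ φ z) (φ z)
      have hx : d.1.r ((φ x : L) ⊔ φ z) (φ z) := Conc.principal_le_iff.1 le_sup_left
      have hy : d.1.r ((φ y : L) ⊔ φ z) (φ z) := Conc.principal_le_iff.1 le_sup_right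
      have := d.1.sup hx hy
      rwa [← sup_sup_distrib_right, sup_idem] at this
    · have key : ∀ {d : LatticeCon L} {r s w : L}, d.r r w → s ≤ r → w ≤ s → d.r s w := by
        intro d r s w h hsr hws
        have := d.inf h (d.refl s)
        rwa [inf_eq_right.2 hsr, inf_eq_left.2 hws] at this
      have h : (Conc.principal ((φ x : L) ⊔ φ y ⊔ φ z) (φ z)).1.r ((φ x : L) ⊔ φ y ⊔ φ z) (φ z) :=
        theta_rel _ _
      refine sup_le (Conc.principal_le_iff.2 ?_) (Conc.principal_le_iff.2 ?_)
      · exact key h (sup_le_sup_right le_sup_left _) le_sup_right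
      · exact key h (sup_le_sup_right le_sup_right _) le_sup_right
  · change Conc.principal ((φ (Presented.gen _ _) : L) ⊔ φ (Presented.gen _ _))
      (φ (Presented.gen _ _)) = _
    rw [hgen, hgen]
    change Conc.principal (p ⊔ q) q = _
    rw [sup_eq_left.2 hqp]
  · intro ξ k
    rw [Conc.principal_le_iff]
    change (a ξ (parity k)).1.r ((φ (Presented.gen _ _) : L) ⊔ φ (Presented.gen _ _))
      (φ (Presented.gen _ _))
    rw [hgen, hgen]
    change (a ξ (parity k)).1.r (t ξ (k + 1) ⊔ t ξ k) (t ξ k)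
    rw [sup_eq_left.2 (hmono ξ (Nat.le_succ k))]
    exact ht ξ k (Nat.le_of_lt_succ k.2)

theorem exists_isRefinementMap_of_altComp {m : ℕ} {Ω : Type v} {x y : L} {a : Ω → Fin 2 → Conc L}
    (h : ∀ ξ, altComp (a ξ 0).1 (a ξ 1).1 m (x ⊓ y) (x ⊔ y)) :
    ∃ c : Sem m Ω → Sem m Ω → Conc L, IsRefinementMap (Conc.principal x y) a c := by
  choose t hmono h0 h1 ht using fun ξ => (h ξ).exists_chain inf_le_sup
  rw [← Conc.principal_sup_inf]
  refine exists_isRefinementMap inf_le_sup t hmono h0 h1 fun ξ i hi => ?_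
  have := ht ξ i hi
  unfold parity
  by_cases he : Even i
  · rwa [if_pos he] at this ⊢
  · rwa [if_neg he] at this ⊢

theorem Conc.rel_of_principal_le {x y : L} {a b : Conc L} (h : Conc.principal x y ≤ a ⊔ b) :
    (a.1 ⊔ b.1).r (x ⊓ y) (x ⊔ y) :=
  Setoid.symm' _ ((LatticeCon.rel_inf_sup_iff _).2 (Conc.principal_le_iff.1 h))

/-- Ω_m consists of the ξ for which the chosen alternating sequence has parameter m. -/
theorem Conc.CLR_principal (x y : L) : CLR.{u, v} (Conc.principal x y) := by
  intro Ω _ a h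
  choose n hn using fun ξ => exists_altComp (Conc.rel_of_principal_le (h ξ))
  choose c hc using fun m : ℕ+ => exists_isRefinementMap_of_altComp
    (a := fun ξ : {ξ | n ξ = m} => a ξ) fun ξ => ξ.2 ▸ hn ξ
  refine ⟨fun m => {ξ | n ξ = m}, fun i j hij => ?_, ?_, c, hc⟩
  · exact Set.disjoint_left.2 fun ξ hi hj => hij (hi.symm.trans hj)
  · exact Set.eq_univ_of_forall fun ξ => Set.mem_iUnion.2 ⟨n ξ, rfl⟩

theorem Conc.CLRm_principal {m : ℕ+} (hL : PermutableSucc L m) (x y : L) :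
    CLRm.{u, v} m (Conc.principal x y) := fun _ _ a h =>
  exists_isRefinementMap_of_altComp fun ξ =>
    (congrFun₂ (hL (a ξ 0).1 (a ξ 1).1) _ _).mp (Conc.rel_of_principal_le (h ξ))

end Congruences

end CLP

theorem theorem8p2 :
    (∀ (L : Type u) [Lattice L] (x y : L),
      CLP.CLR.{u, v} (CLP.Conc.principal x y) ∧
      ∀ m : ℕ+, CLP.PermutableSucc L m → CLP.CLRm.{u, v} m (CLP.Conc.principal x y)) ∧
    (∀ Ω : Type u, #Ω = ℵ_ (ω + 1) → ¬ CLP.CLR.{u, v} (CLP.G.one Ω)) ∧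
    (∀ (m : ℕ+) (Ω : Type u), #Ω = ℵ_ ((2 ^ (m : ℕ) : ℕ) : Ordinal.{u}) →
      ¬ CLP.CLRm.{u, v} m (CLP.G.one Ω)) := by
  refine ⟨fun L _ x y => ⟨CLP.Conc.CLR_principal x y, fun m hm => CLP.Conc.CLRm_principal hm x y⟩,
    fun Ω h => CLP.G.not_CLR h, fun m Ω h => CLP.G.not_CLRm m h⟩
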